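/- Let $m,n\ge 1$. Let $T_{m,n}$ be the toroidal Aztec rectangle graph: take a $(2m+1)\times(2n+1)$ chessboard with black corners, identify its top row with its bottom row and its left column with its right column, let the vertices be the squares that are white on this chessboard, and join two of them if the squares share a corner. (The other squares of the resulting $2m\times 2n$ toroidal board are the 4-cycle faces of $T_{m,n}$.) This graph is bipartite; fix from now on a proper coloring of its vertices with the colors black and white. For a finite graph $G$ let $\mathrm{M}(G)$ be the number of its perfect matchings. A horizontal (resp. vertical) diagonal multiplet, or slit, of length $k\ge 1$ is a run of $k$ distinct consecutive vertices in a row (resp. column) of the board, consecutive ones being two squares apart; its center is the middle square of the run of $2k-1$ squares formed by its $k$ vertices and the $k-1$ faces between consecutive ones. Horizontal (resp. vertical) multiplets of length $k$ exist when $k\le n$ (resp. $k\le m$); if $k=n$ (resp. $k=m$), when the vertices fill a whole row (resp. column), the run, and so the center, is part of the data. All vertices of a multiplet have the same color; it is called white-placed or black-placed accordingly. The flip $\overline{O}$ of a multiplet $O$ is the multiplet of the other direction with the same length and the same center. Let $1\le k\le \min(m,n)$ and $s\ge 0$, and let $O_1,\dots,O_{2s}$ be diagonal multiplets of length $k$ in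 $T_{m,n}$, $s$ of them horizontal and white-placed, the other $s$ vertical and black-placed. Assume that they are mutually disjoint as slits, i.e. no two of them have a vertex in common and no two of them cross (a horizontal and a vertical one cross if some face lies between two consecutive vertices of the one and also between two consecutive vertices of the other); equivalently, their runs of $2k-1$ squares are mutually disjoint. Assume also that $T_{m,n}\setminus (O_1\cup\dots\cup O_{2s})$ has at least one perfect matching. Then $$\mathrm{M}\bigl(T_{m,n}\setminus (O_1\cup\dots\cup O_{2s})\bigr)=\mathrm{M}\bigl(T_{m,n}\setminus (\overline{O}_1\cup\dots\cup \overline{O}_{2s})\bigr).$$ Consequently the finite size correlations $\omega_{m,n}(\,\cdot\,)=\mathrm{M}(T_{m,n}\setminus \bigcup\,\cdot\,)/\mathrm{M}(T_{m,n})$ of the two collections of holes are equal: $\omega_{m,n}(O_1,\dots,O_{2s})=\omega_{m,n}(\overline{O}_1,\dots,\overline{O}_{2s})$. -/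

import Mathlib

namespace AztecTorus

/-- The squares of the chessboard with `2m + 1` rows and `2n + 1` columns, after the top row has been
identified with the bottom row and the left column with the right column.  A square is given by its
row and its column. -/
abbrev Square (m n : ℕ) : Type := ZMod (2 * m) × ZMod (2 * n)

/-- The chessboard color of a square: row plus column modulo `2` (well defined on the torus, since
both circumferences are even).  The corners of the chessboard have parity `0`. -/
def parity {m n : ℕ} (p : Square m n) : ZMod 2 :=
  ZMod.castHom (Dvd.intro m rfl) (ZMod 2) p.1 + ZMod.castHom (Dvd.intro n rfl) (ZMod 2) p.2

/-- The vertices of the toroidal Aztec rectangle: the squares whose chessboard color is not the one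
of the corners.  (The other squares of the torus are the faces of the graph.) -/
abbrev Vertex (m n : ℕ) : Type := {p : Square m n // parity p = 1}

/-- The toroidal Aztec rectangle graph `T_{m,n}`: two vertices are adjacent if the corresponding
squares share a corner. -/
def torus (m n : ℕ) : SimpleGraph (Vertex m n) where
  Adj u v := (v.1.1 = u.1.1 + 1 ∨ v.1.1 = u.1.1 - 1) ∧ (v.1.2 = u.1.2 + 1 ∨ v.1.2 = u.1.2 - 1)
  symm := ⟨by
    rintro u v ⟨h1, h2⟩
    constructor
    · rcases h1 with h | h
      · right; rw [h]; ring
      · left; rw [h]; ring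
    · rcases h2 with h | h
      · right; rw [h]; ring
      · left; rw [h]; ring⟩
  loopless := ⟨by
    rintro u ⟨h, -⟩
    have key : ∀ x : ZMod (2 * m), (x = x + 1 ∨ x = x - 1) → False := by
      intro x hx
      have h1 : (1 : ZMod (2 * m)) = 0 := by
        rcases hx with hx | hx
        · exact (left_eq_add.mp hx)
        · exact (sub_eq_self.mp hx.symm)
      have h2 := congrArg (ZMod.castHom (Dvd.intro m rfl : 2 ∣ 2 * m) (ZMod 2)) h1
      rw [map_one, map_zero] at h2
      exact one_ne_zero h2
    exact key _ h⟩

/-- The number of perfect matchings of a graph. -/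
noncomputable def numPerfectMatchings {V : Type*} (G : SimpleGraph V) : ℕ :=
  Nat.card {M : G.Subgraph // M.IsPerfectMatching}

/-- The graph obtained from `T_{m,n}` by removing the vertices in `S`. -/
abbrev torusWithHoles (m n : ℕ) (S : Set (Vertex m n)) : SimpleGraph ↥(Sᶜ) :=
  (torus m n).induce Sᶜ

/-- The finite size correlation of the holes whose union is `S`. -/
noncomputable def finiteSizeCorrelation (m n : ℕ) (S : Set (Vertex m n)) : ℚ :=
  (numPerfectMatchings (torusWithHoles m n S) : ℚ) / (numPerfectMatchings (torus m n) : ℚ)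

/-- The two directions of the diagonals of the grid graph. -/
inductive Orientation : Type
  | horizontal
  | vertical

/-- The other direction. -/
def Orientation.flip : Orientation → Orientation
  | .horizontal => .vertical
  | .vertical => .horizontal

/-- The displacement by one square in the given direction. -/
def Orientation.step (m n : ℕ) : Orientation → Square m n
  | .horizontal => (0, 1)
  | .vertical => (1, 0)

/-- A diagonal multiplet (slit) of length `k`, given by its direction and its center.  The center is
the middle square of a run of `2k - 1` consecutive squares; the parity condition says that the end
squares of this run, which are `k - 1` squares away from the center, are vertices. -/
structure Multiplet (m n k : ℕ) where
  orientation : Orientation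
  center : Square m n
  parity_center : parity center = (k : ZMod 2)

namespace Multiplet

variable {m n k : ℕ}

/-- The run of `2k - 1` consecutive squares covered by the multiplet, that is its `k` vertices and
the `k - 1` faces between consecutive ones: the `1 × (2k - 1)` (or `(2k - 1) × 1`) chessboard of
which the multiplet consists of the squares with the color of the corners. -/
def board (O : Multiplet m n k) : Set (Square m n) :=
  {p | ∃ t : ℤ, |t| < (k : ℤ) ∧ p = O.center + t • O.orientation.step m n}

/-- The set of the `k` vertices that form the multiplet. -/
def verts (O : Multiplet m n k) : Set (Vertex m n) :=
  {v | v.1 ∈ O.board}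

/-- The multiplet of the other direction with the same length and the same center. -/
def flip (O : Multiplet m n k) : Multiplet m n k where
  orientation := O.orientation.flip
  center := O.center
  parity_center := O.parity_center

/-- All the vertices of the multiplet have the color `b`.  (`true` stands for white, `false` for
black.) -/
def IsPlaced (O : Multiplet m n k) (C : (torus m n).Coloring Bool) (b : Bool) : Prop :=
  ∀ v ∈ O.verts, C v = b

end Multiplet

end AztecTorus

set_option linter.unusedSectionVars false

namespace AztecTorus

open Finset

/-- The number of edges of a set `e` of edges of a 4-cycle at a given corner.  The corners of a cell
are `(false, a)` and `(true, b)`; its edges join `(false, a)` to `(true, b)`. -/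
def cellDegree (e : Bool → Bool → Bool) : Bool × Bool → ℕ
  | (false, a) => ∑ b, (e a b).toNat
  | (true, b) => ∑ a, (e a b).toNat

/-- The number of matchings of a cell that cover a given set of corners. -/
def cellWeight (κ : Bool × Bool → Bool) : ℕ :=
  #{e : Bool → Bool → Bool | ∀ x, cellDegree e x = (κ x).toNat}

/-- The complementary set of corners. -/
def cellCompl (κ : Bool × Bool → Bool) : Bool × Bool → Bool := fun x => !κ x

theorem cellWeight_compl_cases (a b c d : Bool) :
    ∀ κ, κ = (fun x : Bool × Bool => bif x.1 then (bif x.2 then a else b) else (bif x.2 then c else d)) →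
    (cellWeight κ = 0 ∧ cellWeight (cellCompl κ) = 0) ∨
    (cellWeight κ = 2 ∧ cellWeight (cellCompl κ) = 1 ∧ ∑ x, (κ x).toNat = 4) ∨
    (cellWeight κ = 1 ∧ cellWeight (cellCompl κ) = 1 ∧ ∑ x, (κ x).toNat = 2) ∨
    (cellWeight κ = 1 ∧ cellWeight (cellCompl κ) = 2 ∧ ∑ x, (κ x).toNat = 0) := by
  rintro κ rfl
  revert a b c d
  decide +kernel

theorem cellWeight_compl (κ : Bool × Bool → Bool) :
    (cellWeight κ = 0 ∧ cellWeight (cellCompl κ) = 0) ∨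
    (cellWeight κ = 2 ∧ cellWeight (cellCompl κ) = 1 ∧ ∑ x, (κ x).toNat = 4) ∨
    (cellWeight κ = 1 ∧ cellWeight (cellCompl κ) = 1 ∧ ∑ x, (κ x).toNat = 2) ∨
    (cellWeight κ = 1 ∧ cellWeight (cellCompl κ) = 2 ∧ ∑ x, (κ x).toNat = 0) := by
  refine cellWeight_compl_cases (κ (true, true)) (κ (true, false)) (κ (false, true))
    (κ (false, false)) κ ?_
  funext ⟨x, y⟩
  cases x <;> cases y <;> rfl

theorem cellWeight_mul_pow {r : ℝ} (hr : r ^ 4 = 2) (κ : Bool × Bool → Bool) :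
    (cellWeight κ : ℝ) * r ^ (∑ x, (cellCompl κ x).toNat) =
      cellWeight (cellCompl κ) * r ^ (∑ x, (κ x).toNat) := by
  have hsum : ∑ x, (cellCompl κ x).toNat + ∑ x, (κ x).toNat = 4 := by
    rw [← sum_add_distrib]
    have : ∀ x, (cellCompl κ x).toNat + (κ x).toNat = 1 := by
      intro x; unfold cellCompl; cases κ x <;> rfl
    simp [this]
  rcases cellWeight_compl κ with ⟨h1, h2⟩ | ⟨h1, h2, h3⟩ | ⟨h1, h2, h3⟩ | ⟨h1, h2, h3⟩
  · simp [h1, h2]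
  · have : ∑ x, (cellCompl κ x).toNat = 0 := by omega
    rw [this, h1, h2, h3, hr]; norm_num
  · have : ∑ x, (cellCompl κ x).toNat = 2 := by omega
    rw [this, h1, h2, h3]
  · have : ∑ x, (cellCompl κ x).toNat = 4 := by omega
    rw [this, h1, h2, h3, hr]; norm_num

/-- If the two corners on one side of the bipartition of a cell are not covered, nothing is. -/
theorem eq_false_of_cellWeight_ne_zero {κ : Bool × Bool → Bool} (hw : cellWeight κ ≠ 0) {i : Bool}
    (hi : ∀ a, κ (i, a) = false) (x : Bool × Bool) : κ x = false := by
  obtain ⟨e, he⟩ := card_ne_zero.mp hw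
  simp only [mem_filter, mem_univ, true_and] at he
  have h0 : ∀ a b, e a b = false := by
    intro a b
    cases i
    · have := he (false, a)
      rw [hi a] at this
      simp only [cellDegree, Bool.toNat_false, sum_eq_zero_iff, mem_univ, true_implies] at this
      have := this b
      revert this; cases e a b <;> simp
    · have := he (true, b)
      rw [hi b] at this
      simp only [cellDegree, Bool.toNat_false, sum_eq_zero_iff, mem_univ, true_implies] at this
      have := this a
      revert this; cases e a b <;> simp
  have hx := he x
  obtain ⟨i, a⟩ := x
  revert hx
  cases i <;> simp [cellDegree, h0] <;> cases κ _ <;> simp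

section Cellular

variable {V K : Type*} [Fintype V] [Fintype K] [DecidableEq V] [DecidableEq K]

/-- The sum of `f` over all corners that are glued to the vertex `u`. -/
def cornerSum (corner : K → Bool × Bool → V) (f : K → Bool × Bool → ℕ) (u : V) : ℕ :=
  ∑ c, ∑ x, if corner c x = u then f c x else 0

/-- The number of edge sets with prescribed degrees in the graph obtained by gluing cells. -/
def cellularCount (corner : K → Bool × Bool → V) (d : V → ℕ) : ℕ :=
  #{E : K → Bool → Bool → Bool | ∀ u, cornerSum corner (fun c => cellDegree (E c)) u = d u}

variable {corner : K → Bool × Bool → V}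

theorem le_cornerSum (f : K → Bool × Bool → ℕ) (c : K) (x : Bool × Bool) :
    f c x ≤ cornerSum corner f (corner c x) := by
  unfold cornerSum
  refine le_trans ?_ (single_le_sum (fun _ _ => Nat.zero_le _) (mem_univ c))
  refine le_trans ?_ (single_le_sum (fun _ _ => Nat.zero_le _) (mem_univ x))
  simp

theorem sum_cornerSum (f : K → Bool × Bool → ℕ) :
    ∑ u, cornerSum corner f u = ∑ c, ∑ x, f c x := by
  unfold cornerSum
  rw [sum_comm]
  refine sum_congr rfl fun c _ => ?_
  rw [sum_comm]
  refine sum_congr rfl fun x _ => ?_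
  simp

theorem cornerSum_add (f g : K → Bool × Bool → ℕ) (u : V) :
    cornerSum corner f u + cornerSum corner g u = cornerSum corner (fun c x => f c x + g c x) u := by
  unfold cornerSum
  rw [← sum_add_distrib]
  refine sum_congr rfl fun c _ => ?_
  rw [← sum_add_distrib]
  refine sum_congr rfl fun x _ => ?_
  split_ifs <;> simp

/-- The contribution of a set of covered corners to the weighted count of edge sets. -/
def coverTerm (corner : K → Bool × Bool → V) (d : V → ℕ) (κ : K → Bool × Bool → Bool) : ℕ :=
  if ∀ u, cornerSum corner (fun c x => (κ c x).toNat) u = d u then ∏ c, cellWeight (κ c) else 0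

theorem cellularCount_eq_sum {d : V → ℕ} (hd : ∀ u, d u ≤ 1) :
    cellularCount corner d = ∑ κ, coverTerm corner d κ := by
  classical
  let Φ : (K → Bool → Bool → Bool) → (K → Bool × Bool → Bool) :=
    fun E c x => decide (cellDegree (E c) x = 1)
  unfold cellularCount
  rw [card_eq_sum_card_fiberwise (f := Φ) (t := univ) (fun _ _ => mem_univ _)]
  refine sum_congr rfl fun κ _ => ?_
  unfold coverTerm
  have key : ∀ E, (∀ u, cornerSum corner (fun c => cellDegree (E c)) u = d u) → Φ E = κ →
      ∀ c x, cellDegree (E c) x = (κ c x).toNat := by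
    rintro E hE rfl c x
    have h1 := le_cornerSum (corner := corner) (fun c => cellDegree (E c)) c x
    rw [hE] at h1
    have h2 := h1.trans (hd _)
    simp only [Φ]
    interval_cases h : cellDegree (E c) x <;> simp
  have key2 : ∀ E, (∀ c x, cellDegree (E c) x = (κ c x).toNat) → Φ E = κ := by
    intro E hE
    funext c x
    simp only [Φ, hE]
    cases κ c x <;> simp
  split_ifs with h
  · rw [show (∏ c, cellWeight (κ c)) = #(Fintype.piFinset fun c =>
      ({e : Bool → Bool → Bool | ∀ x, cellDegree e x = (κ c x).toNat} : Finset _)) from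
      (Fintype.card_piFinset _).symm]
    congr 1
    ext E
    simp only [mem_filter, mem_univ, true_and, Fintype.mem_piFinset]
    constructor
    · rintro ⟨h1, h2⟩
      exact key E h1 h2
    · intro h1
      refine ⟨fun u => ?_, key2 E h1⟩
      rw [← h u]
      congr 1
      funext c x
      exact h1 c x
  · rw [card_eq_zero, filter_eq_empty_iff]
    intro E hE h2
    simp only [mem_filter, mem_univ, true_and] at hE
    apply h
    intro u
    rw [← hE u]
    congr 1
    funext c x
    exact (key E hE h2 c x).symm

theorem eq_false_of_coverTerm_ne_zero {d : V → ℕ} {κ : K → Bool × Bool → Bool}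
    (h : coverTerm corner d κ ≠ 0) {c : K} {i : Bool} (hc : ∀ a, d (corner c (i, a)) = 0)
    (x : Bool × Bool) : κ c x = false := by
  unfold coverTerm at h
  split_ifs at h with h1
  · refine eq_false_of_cellWeight_ne_zero (prod_ne_zero_iff.mp h c (mem_univ c)) (i := i) ?_ x
    intro a
    have h2 := le_cornerSum (corner := corner) (fun c x => (κ c x).toNat) c (i, a)
    rw [h1, hc a] at h2
    revert h2
    simp only [nonpos_iff_eq_zero]
    cases κ c (i, a) <;> simp
  · exact absurd rfl h

/-- Complement the set of covered corners in all cells outside `F`. -/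
def toggleOutside (F : Finset K) : (K → Bool × Bool → Bool) ≃ (K → Bool × Bool → Bool) where
  toFun κ c := if c ∈ F then κ c else cellCompl (κ c)
  invFun κ c := if c ∈ F then κ c else cellCompl (κ c)
  left_inv κ := by
    funext c x
    by_cases h : c ∈ F <;> simp [h, cellCompl]
  right_inv κ := by
    funext c x
    by_cases h : c ∈ F <;> simp [h, cellCompl]

theorem toNat_add_toNat_toggleOutside {F : Finset K} {κ : K → Bool × Bool → Bool}
    (hκ : ∀ c ∈ F, ∀ x, κ c x = false) (c : K) (x : Bool × Bool) :
    (κ c x).toNat + (toggleOutside F κ c x).toNat = if c ∈ F then 0 else 1 := by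
  by_cases h : c ∈ F
  · simp [toggleOutside, h, hκ c h]
  · simp only [toggleOutside, Equiv.coe_fn_mk, h, if_false, cellCompl]
    cases κ c x <;> rfl

theorem coverTerm_mul_pow {r : ℝ} (hr : r ^ 4 = 2) {d d' : V → ℕ} {F : Finset K}
    (hdd : ∀ u, d u + d' u = cornerSum corner (fun c _ => if c ∈ F then 0 else 1) u)
    {κ : K → Bool × Bool → Bool} (hκ : ∀ c ∈ F, ∀ x, κ c x = false) :
    (coverTerm corner d κ : ℝ) * r ^ (∑ u, d' u) =
      coverTerm corner d' (toggleOutside F κ) * r ^ (∑ u, d u) := by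
  set κ' := toggleOutside F κ with hκ'
  have hadd : ∀ u, cornerSum corner (fun c x => (κ c x).toNat) u +
      cornerSum corner (fun c x => (κ' c x).toNat) u = d u + d' u := by
    intro u
    rw [cornerSum_add, hdd]
    congr 1
    funext c x
    exact toNat_add_toNat_toggleOutside hκ c x
  unfold coverTerm
  by_cases h : ∀ u, cornerSum corner (fun c x => (κ c x).toNat) u = d u
  · have h' : ∀ u, cornerSum corner (fun c x => (κ' c x).toNat) u = d' u := by
      intro u
      have := hadd u
      rw [h u] at this
      omega
    rw [if_pos h, if_pos h']
    have e1 : ∑ u, d u = ∑ c, ∑ x, (κ c x).toNat := by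
      rw [← sum_cornerSum (corner := corner)]
      exact sum_congr rfl fun u _ => (h u).symm
    have e2 : ∑ u, d' u = ∑ c, ∑ x, (κ' c x).toNat := by
      rw [← sum_cornerSum (corner := corner)]
      exact sum_congr rfl fun u _ => (h' u).symm
    rw [e1, e2, ← prod_pow_eq_pow_sum, ← prod_pow_eq_pow_sum]
    push_cast
    rw [← prod_mul_distrib, ← prod_mul_distrib]
    refine prod_congr rfl fun c _ => ?_
    by_cases hc : c ∈ F
    · have : κ' c = κ c := by simp [hκ', toggleOutside, hc]
      rw [this]
    · have : κ' c = cellCompl (κ c) := by simp [hκ', toggleOutside, hc]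
      rw [this]
      exact cellWeight_mul_pow hr (κ c)
  · have h' : ¬ ∀ u, cornerSum corner (fun c x => (κ' c x).toNat) u = d' u := by
      intro h'
      apply h
      intro u
      have := hadd u
      rw [h' u] at this
      omega
    rw [if_neg h, if_neg h']
    simp

/-- The complementation principle for graphs glued from 4-cycles. -/
theorem cellularCount_mul_pow {r : ℝ} (hr : r ^ 4 = 2) {d d' : V → ℕ} {F : Finset K}
    (hd : ∀ u, d u ≤ 1) (hd' : ∀ u, d' u ≤ 1)
    (hdd : ∀ u, d u + d' u = cornerSum corner (fun c _ => if c ∈ F then 0 else 1) u)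
    (hF : ∀ c ∈ F, ∃ i, ∀ a, d (corner c (i, a)) = 0)
    (hF' : ∀ c ∈ F, ∃ i, ∀ a, d' (corner c (i, a)) = 0) :
    (cellularCount corner d : ℝ) * r ^ (∑ u, d' u) =
      cellularCount corner d' * r ^ (∑ u, d u) := by
  rw [cellularCount_eq_sum hd, cellularCount_eq_sum hd',
    ← (toggleOutside F).sum_comp (fun κ => coverTerm corner d' κ)]
  push_cast
  rw [sum_mul, sum_mul]
  refine sum_congr rfl fun κ _ => ?_
  by_cases h : ∀ c ∈ F, ∀ x, κ c x = false
  · exact coverTerm_mul_pow hr hdd h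
  · have h1 : coverTerm corner d κ = 0 := by
      by_contra hne
      apply h
      intro c hc x
      obtain ⟨i, hi⟩ := hF c hc
      exact eq_false_of_coverTerm_ne_zero hne hi x
    have h2 : coverTerm corner d' (toggleOutside F κ) = 0 := by
      by_contra hne
      apply h
      intro c hc x
      obtain ⟨i, hi⟩ := hF' c hc
      have := eq_false_of_coverTerm_ne_zero hne hi x
      simpa [toggleOutside, hc] using this
    rw [h1, h2]
    simp

theorem le_cornerSum_of_cellularCount_ne_zero {d : V → ℕ} {F : Finset K}
    (hd : ∀ u, d u ≤ 1) (hF : ∀ c ∈ F, ∃ i, ∀ a, d (corner c (i, a)) = 0)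
    (hne : cellularCount corner d ≠ 0) (u : V) :
    d u ≤ cornerSum corner (fun c _ => if c ∈ F then 0 else 1) u := by
  rw [cellularCount_eq_sum hd] at hne
  obtain ⟨κ, -, hκ⟩ := exists_ne_zero_of_sum_ne_zero hne
  have hempty : ∀ c ∈ F, ∀ x, κ c x = false := by
    intro c hc x
    obtain ⟨i, hi⟩ := hF c hc
    exact eq_false_of_coverTerm_ne_zero hκ hi x
  unfold coverTerm at hκ
  split_ifs at hκ with h
  · rw [← h u]
    unfold cornerSum
    refine sum_le_sum fun c _ => sum_le_sum fun x _ => ?_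
    by_cases h1 : corner c x = u
    · by_cases h2 : c ∈ F
      · simp [hempty c h2]
      · simp only [h1, h2, if_true, if_false]
        exact Bool.toNat_le _
    · simp [h1]
  · exact absurd rfl hκ

end Cellular

section Cellular

variable {V K : Type*} [Fintype V] [Fintype K] [DecidableEq V] [DecidableEq K]

/-- `G` is obtained by gluing 4-cycles along their corners, without creating multiple edges. -/
structure IsCellular (G : SimpleGraph V) (corner : K → Bool × Bool → V) : Prop where
  adj_iff : ∀ u w, G.Adj u w ↔ ∃ c a b, (u = corner c (false, a) ∧ w = corner c (true, b)) ∨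
    (w = corner c (false, a) ∧ u = corner c (true, b))
  inj : ∀ c a b c' a' b', corner c (false, a) = corner c' (false, a') →
    corner c (true, b) = corner c' (true, b') → (c, a, b) = (c', a', b')
  ne : ∀ c a c' b, corner c (false, a) ≠ corner c' (true, b)

/-- The edge of a cell encoded by `t` has `u` as an endpoint. -/
def Incident (corner : K → Bool × Bool → V) (t : K × Bool × Bool) (u : V) : Prop :=
  corner t.1 (false, t.2.1) = u ∨ corner t.1 (true, t.2.2) = u

variable {corner : K → Bool × Bool → V} {G : SimpleGraph V}

open Classical in
theorem cornerSum_cellDegree (hG : IsCellular G corner) (E : K → Bool → Bool → Bool) (u : V) :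
    cornerSum corner (fun c => cellDegree (E c)) u =
      #{t : K × Bool × Bool | E t.1 t.2.1 t.2.2 = true ∧ Incident corner t u} := by
  rw [card_filter, Fintype.sum_prod_type]
  unfold cornerSum
  refine sum_congr rfl fun c _ => ?_
  have key : ∀ a b, (if E c a b = true ∧ Incident corner (c, a, b) u then 1 else 0) =
      (if corner c (false, a) = u then (E c a b).toNat else 0) +
      (if corner c (true, b) = u then (E c a b).toNat else 0) := by
    intro a b
    have := hG.ne c a c b
    unfold Incident
    cases E c a b
    · simp
    · by_cases h1 : corner c (false, a) = u
      · have h2 : corner c (true, b) ≠ u := by rw [← h1]; exact this.symm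
        simp [h1, h2]
      · simp [h1]
  rw [Fintype.sum_prod_type, Fintype.sum_prod_type]
  simp only [key, Fintype.sum_bool, cellDegree]
  split_ifs <;> ring

theorem cornerSum_eq_iff (hG : IsCellular G corner) (E : K → Bool → Bool → Bool) (S : Set V)
    [DecidablePred (· ∈ S)] :
    (∀ u, cornerSum corner (fun c => cellDegree (E c)) u = if u ∈ S then 0 else 1) ↔
    (∀ u ∈ S, ∀ t : K × Bool × Bool, E t.1 t.2.1 t.2.2 = true → ¬ Incident corner t u) ∧
    (∀ u ∉ S, ∃! t : K × Bool × Bool, E t.1 t.2.1 t.2.2 = true ∧ Incident corner t u) := by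
  classical
  simp only [cornerSum_cellDegree hG]
  constructor
  · intro h
    constructor
    · intro u hu t h1 h2
      have := h u
      rw [if_pos hu, card_eq_zero, filter_eq_empty_iff] at this
      exact this (mem_univ t) ⟨h1, h2⟩
    · intro u hu
      have := h u
      rw [if_neg hu, card_eq_one] at this
      obtain ⟨t, ht⟩ := this
      simp only [Finset.ext_iff, mem_filter, mem_univ, true_and, mem_singleton] at ht
      exact ⟨t, (ht t).mpr rfl, fun t' h' => (ht t').mp h'⟩
  · rintro ⟨h1, h2⟩ u
    split_ifs with hu
    · rw [card_eq_zero, filter_eq_empty_iff]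
      rintro t - ⟨h3, h4⟩
      exact h1 u hu t h3 h4
    · obtain ⟨t, ht, hu⟩ := h2 u hu
      rw [card_eq_one]
      refine ⟨t, ?_⟩
      ext t'
      simp only [mem_filter, mem_univ, true_and, mem_singleton]
      exact ⟨hu t', fun h => h ▸ ht⟩

open Classical in
/-- The edge set of a subgraph, cell by cell. -/
noncomputable def edgeCode (corner : K → Bool × Bool → V) {S : Set V} (M : (G.induce Sᶜ).Subgraph) :
    K → Bool → Bool → Bool :=
  fun c a b => decide (∃ hu hv, M.Adj ⟨corner c (false, a), hu⟩ ⟨corner c (true, b), hv⟩)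

theorem edgeCode_eq_true {S : Set V} {M : (G.induce Sᶜ).Subgraph} {c : K} {a b : Bool} :
    edgeCode corner M c a b = true ↔
      ∃ hu hv, M.Adj ⟨corner c (false, a), hu⟩ ⟨corner c (true, b), hv⟩ := by
  simp [edgeCode]

/-- The subgraph with a given edge set. -/
def ofEdgeCode (hG : IsCellular G corner) (S : Set V) (E : K → Bool → Bool → Bool) :
    (G.induce Sᶜ).Subgraph where
  verts := Set.univ
  Adj u w := ∃ c a b, E c a b = true ∧ ((u.1 = corner c (false, a) ∧ w.1 = corner c (true, b)) ∨
    (w.1 = corner c (false, a) ∧ u.1 = corner c (true, b)))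
  adj_sub := by
    rintro u w ⟨c, a, b, -, h⟩
    exact (hG.adj_iff _ _).mpr ⟨c, a, b, h⟩
  edge_vert := fun _ => Set.mem_univ _
  symm := ⟨by
    rintro u w ⟨c, a, b, h1, h⟩
    exact ⟨c, a, b, h1, h.symm⟩⟩

theorem edgeCode_ofEdgeCode (hG : IsCellular G corner) (S : Set V) [DecidablePred (· ∈ S)]
    {E : K → Bool → Bool → Bool}
    (hE : ∀ u, cornerSum corner (fun c => cellDegree (E c)) u = if u ∈ S then 0 else 1) :
    edgeCode corner (ofEdgeCode hG S E) = E := by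
  rw [cornerSum_eq_iff hG] at hE
  funext c a b
  rw [Bool.eq_iff_iff, edgeCode_eq_true]
  constructor
  · rintro ⟨hu, hv, c', a', b', h1, ⟨h2, h3⟩ | ⟨h2, h3⟩⟩
    · have := hG.inj _ _ _ _ _ _ h2 h3
      simp only [Prod.mk.injEq] at this
      obtain ⟨rfl, rfl, rfl⟩ := this
      exact h1
    · exact absurd h3 (hG.ne _ _ _ _)
  · intro h
    refine ⟨fun hS => hE.1 _ hS (c, a, b) h (Or.inl rfl), fun hS => hE.1 _ hS (c, a, b) h (Or.inr rfl),
      c, a, b, h, Or.inl ⟨rfl, rfl⟩⟩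

theorem ofEdgeCode_isPerfectMatching (hG : IsCellular G corner) (S : Set V) [DecidablePred (· ∈ S)]
    {E : K → Bool → Bool → Bool}
    (hE : ∀ u, cornerSum corner (fun c => cellDegree (E c)) u = if u ∈ S then 0 else 1) :
    (ofEdgeCode hG S E).IsPerfectMatching := by
  rw [cornerSum_eq_iff hG] at hE
  rw [SimpleGraph.Subgraph.isPerfectMatching_iff]
  rintro ⟨u, hu⟩
  obtain ⟨⟨c, a, b⟩, ⟨h1, h2⟩, h3⟩ := hE.2 u hu
  rcases h2 with h2 | h2
  · refine ⟨⟨corner c (true, b), fun hS => hE.1 _ hS (c, a, b) h1 (Or.inr rfl)⟩,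
      ⟨c, a, b, h1, Or.inl ⟨h2.symm, rfl⟩⟩, ?_⟩
    rintro ⟨w, hw⟩ ⟨c', a', b', h4, ⟨h5, h6⟩ | ⟨h5, h6⟩⟩
    · have := h3 (c', a', b') ⟨h4, Or.inl h5.symm⟩
      simp only [Prod.mk.injEq] at this
      obtain ⟨rfl, rfl, rfl⟩ := this
      exact Subtype.ext h6
    · exact absurd (h2.trans h6) (hG.ne _ _ _ _)
  · refine ⟨⟨corner c (false, a), fun hS => hE.1 _ hS (c, a, b) h1 (Or.inl rfl)⟩,
      ⟨c, a, b, h1, Or.inr ⟨rfl, h2.symm⟩⟩, ?_⟩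
    rintro ⟨w, hw⟩ ⟨c', a', b', h4, ⟨h5, h6⟩ | ⟨h5, h6⟩⟩
    · exact absurd (h2.trans h5).symm (hG.ne _ _ _ _)
    · have := h3 (c', a', b') ⟨h4, Or.inr h6.symm⟩
      simp only [Prod.mk.injEq] at this
      obtain ⟨rfl, rfl, rfl⟩ := this
      exact Subtype.ext h5

theorem cornerSum_edgeCode (hG : IsCellular G corner) (S : Set V) [DecidablePred (· ∈ S)]
    {M : (G.induce Sᶜ).Subgraph} (hM : M.IsPerfectMatching) (u : V) :
    cornerSum corner (fun c => cellDegree (edgeCode corner M c)) u = if u ∈ S then 0 else 1 := by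
  revert u
  rw [cornerSum_eq_iff hG]
  rw [SimpleGraph.Subgraph.isPerfectMatching_iff] at hM
  constructor
  · rintro u hu ⟨c, a, b⟩ h1 (h2 | h2)
    · obtain ⟨h3, h4, -⟩ := edgeCode_eq_true.mp h1
      exact h3 (h2.symm ▸ hu)
    · obtain ⟨h3, h4, -⟩ := edgeCode_eq_true.mp h1
      exact h4 (h2.symm ▸ hu)
  · intro u hu
    obtain ⟨⟨w, hw⟩, h1, h2⟩ := hM ⟨u, hu⟩
    obtain ⟨c, a, b, ⟨rfl, rfl⟩ | ⟨rfl, rfl⟩⟩ := (hG.adj_iff _ _).mp (M.adj_sub h1)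
    · refine ⟨(c, a, b), ⟨edgeCode_eq_true.mpr ⟨hu, hw, h1⟩, Or.inl rfl⟩, ?_⟩
      rintro ⟨c', a', b'⟩ ⟨h3, h4 | h4⟩
      · obtain ⟨h5, h6, h7⟩ := edgeCode_eq_true.mp h3
        simp only at h4 h7
        have h8 := h2 ⟨_, h6⟩ (by simpa only [h4] using h7)
        exact hG.inj _ _ _ _ _ _ h4 (congrArg Subtype.val h8)
      · exact absurd h4.symm (hG.ne _ _ _ _)
    · refine ⟨(c, a, b), ⟨edgeCode_eq_true.mpr ⟨hw, hu, h1.symm⟩, Or.inr rfl⟩, ?_⟩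
      rintro ⟨c', a', b'⟩ ⟨h3, h4 | h4⟩
      · exact absurd h4 (hG.ne _ _ _ _)
      · obtain ⟨h5, h6, h7⟩ := edgeCode_eq_true.mp h3
        simp only at h4 h7
        have h8 := h2 ⟨_, h5⟩ (by simpa only [h4] using h7.symm)
        exact hG.inj _ _ _ _ _ _ (congrArg Subtype.val h8) h4

theorem edgeCode_injOn (hG : IsCellular G corner) {S : Set V}
    {M N : (G.induce Sᶜ).Subgraph} (hM : M.IsPerfectMatching) (hN : N.IsPerfectMatching)
    (h : edgeCode corner M = edgeCode corner N) : M = N := by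
  have key : ∀ {M N : (G.induce Sᶜ).Subgraph}, edgeCode corner M = edgeCode corner N →
      ∀ u w, M.Adj u w → N.Adj u w := by
    rintro M N h ⟨u, hu⟩ ⟨w, hw⟩ h1
    obtain ⟨c, a, b, ⟨rfl, rfl⟩ | ⟨rfl, rfl⟩⟩ := (hG.adj_iff _ _).mp (M.adj_sub h1)
    · have h2 : edgeCode corner M c a b = true := edgeCode_eq_true.mpr ⟨hu, hw, h1⟩
      rw [h] at h2
      exact (edgeCode_eq_true.mp h2).2.2
    · have h2 : edgeCode corner M c a b = true := edgeCode_eq_true.mpr ⟨hw, hu, h1.symm⟩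
      rw [h] at h2
      exact (edgeCode_eq_true.mp h2).2.2.symm
  ext u w
  · simp [hM.2 u, hN.2 u]
  · exact ⟨key h u w, key h.symm u w⟩

theorem numPerfectMatchings_induce_compl (hG : IsCellular G corner) (S : Set V)
    [DecidablePred (· ∈ S)] :
    numPerfectMatchings (G.induce Sᶜ) =
      cellularCount corner (fun u => if u ∈ S then 0 else 1) := by
  unfold numPerfectMatchings cellularCount
  rw [← Fintype.card_subtype, ← Nat.card_eq_fintype_card]
  refine Nat.card_eq_of_bijective
    (fun M => ⟨edgeCode corner M.1, cornerSum_edgeCode hG S M.2⟩) ⟨?_, ?_⟩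
  · rintro ⟨M, hM⟩ ⟨N, hN⟩ h
    exact Subtype.ext (edgeCode_injOn hG hM hN (congrArg Subtype.val h))
  · rintro ⟨E, hE⟩
    exact ⟨⟨ofEdgeCode hG S E, ofEdgeCode_isPerfectMatching hG S hE⟩,
      Subtype.ext (edgeCode_ofEdgeCode hG S hE)⟩

end Cellular

theorem zmod_two_add_one_add_one (ρ : ZMod 2) : ρ + 1 + 1 = ρ := by
  revert ρ; decide

theorem zmod_two_add_one_ne (ρ : ZMod 2) : ρ + 1 ≠ ρ := by
  revert ρ; decide

theorem zmod_two_add_succ (ρ : ZMod 2) : ρ + (ρ + 1) = 1 := by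
  revert ρ; decide

theorem zmod_two_eq_add_one_of_ne {x y : ZMod 2} (h : x ≠ y) : x = y + 1 := by
  revert x y; decide

section Residue

variable {m : ℕ}

/-- The parity of a row or column of the torus. -/
def residue (z : ZMod (2 * m)) : ZMod 2 := ZMod.castHom (Dvd.intro m rfl) (ZMod 2) z

@[simp] theorem residue_add (x y : ZMod (2 * m)) : residue (x + y) = residue x + residue y :=
  map_add _ _ _

@[simp] theorem residue_sub (x y : ZMod (2 * m)) : residue (x - y) = residue x - residue y :=
  map_sub _ _ _

@[simp] theorem residue_one : residue (1 : ZMod (2 * m)) = 1 := map_one _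

@[simp] theorem residue_zero : residue (0 : ZMod (2 * m)) = 0 := map_zero _

@[simp] theorem residue_intCast (t : ℤ) : residue (t : ZMod (2 * m)) = (t : ZMod 2) :=
  map_intCast _ _

theorem parity_eq {m n : ℕ} (p : Square m n) : parity p = residue p.1 + residue p.2 := rfl

theorem residue_snd_of_fst {n : ℕ} {p : Square m n} (hp : parity p = 1) {ρ : ZMod 2}
    (h : residue p.1 = ρ) : residue p.2 = ρ + 1 := by
  rw [parity_eq, h] at hp
  rw [← hp, ← add_assoc, CharTwo.add_self_eq_zero, zero_add]

/-- `z` is at distance less than `b` from `0`. -/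
def Near (b : ℕ) (z : ZMod (2 * m)) : Prop := ∃ t : ℤ, |t| < (b : ℤ) ∧ (t : ZMod (2 * m)) = z

theorem near_intCast {b : ℕ} (hb : b ≤ m) {t : ℤ} (h1 : -(m : ℤ) ≤ t) (h2 : t ≤ m + 1) :
    Near b (t : ZMod (2 * m)) ↔ (-(b : ℤ) < t ∧ t < b) ∨ (-(b : ℤ) < t - 2 * m ∧ t - 2 * m < b) := by
  constructor
  · rintro ⟨s, hs, hst⟩
    rw [abs_lt] at hs
    rw [ZMod.intCast_eq_intCast_iff_dvd_sub] at hst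
    obtain ⟨l, hl⟩ := hst
    push_cast at hl
    have hb' : (b : ℤ) ≤ m := by exact_mod_cast hb
    have hlm : t - s = 2 * (m * l) := by rw [hl]; ring
    have hl1 : l < 2 := by
      by_contra hl1
      have : (m : ℤ) * 2 ≤ m * l := by
        apply mul_le_mul_of_nonneg_left <;> omega
      omega
    have hl2 : -1 < l := by
      by_contra hl2
      have : (m : ℤ) * l ≤ m * (-1) := by
        apply mul_le_mul_of_nonneg_left <;> omega
      omega
    have : l = 0 ∨ l = 1 := by omega
    rcases this with rfl | rfl
    · left; constructor <;> omega
    · right; constructor <;> omega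
  · rintro (h | h)
    · exact ⟨t, abs_lt.mpr h, rfl⟩
    · refine ⟨t - 2 * m, abs_lt.mpr h, ?_⟩
      rw [ZMod.intCast_eq_intCast_iff_dvd_sub]
      exact ⟨1, by push_cast; ring⟩

theorem exists_rep (hm : 1 ≤ m) (z : ZMod (2 * m)) :
    ∃ t : ℤ, -(m : ℤ) < t ∧ t ≤ m ∧ (t : ZMod (2 * m)) = z := by
  have : NeZero (2 * m) := ⟨by omega⟩
  have h := ZMod.valMinAbs_mem_Ioc z
  rw [Set.mem_Ioc] at h
  push_cast at h
  exact ⟨z.valMinAbs, by omega, by omega, ZMod.coe_valMinAbs z⟩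

theorem two_dvd_of_residue {b : ℕ} {t : ℤ} (h : residue (t : ZMod (2 * m)) = (b : ZMod 2)) :
    (2 : ℤ) ∣ b - t := by
  rw [residue_intCast] at h
  have : ((t : ℤ) : ZMod 2) = ((b : ℤ) : ZMod 2) := by rw [h]; simp
  rw [ZMod.intCast_eq_intCast_iff_dvd_sub] at this
  exact_mod_cast this

open Classical in
theorem near_add_near_succ {b : ℕ} (hb0 : 1 ≤ b) (hb : b + 1 ≤ m) {z : ZMod (2 * m)}
    (hz : residue z = (b : ZMod 2)) :
    (if Near b z then 1 else 0) + (if Near (b + 1) z then 1 else 0) =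
      (if Near b (z + 1) then 1 else 0) + (if Near b (z - 1) then 1 else 0) := by
  obtain ⟨t, h1, h2, rfl⟩ := exists_rep (by omega) z
  have hd := two_dvd_of_residue hz
  have e1 : ((t : ZMod (2 * m)) + 1) = ((t + 1 : ℤ) : ZMod (2 * m)) := by push_cast; rfl
  have e2 : ((t : ZMod (2 * m)) - 1) = ((t - 1 : ℤ) : ZMod (2 * m)) := by push_cast; rfl
  rw [e1, e2]
  simp only [near_intCast (show b ≤ m by omega) (show -(m : ℤ) ≤ t by omega) (show t ≤ m + 1 by omega),
    near_intCast hb (show -(m : ℤ) ≤ t by omega) (show t ≤ m + 1 by omega),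
    near_intCast (show b ≤ m by omega) (show -(m : ℤ) ≤ t + 1 by omega) (show t + 1 ≤ m + 1 by omega),
    near_intCast (show b ≤ m by omega) (show -(m : ℤ) ≤ t - 1 by omega) (show t - 1 ≤ m + 1 by omega)]
  push_cast
  split_ifs <;> omega

theorem near_succ_iff {b : ℕ} {z : ZMod (2 * m)} (hz : residue z = (b : ZMod 2) + 1) :
    Near (b + 1) z ↔ Near b z := by
  constructor
  · rintro ⟨t, h1, rfl⟩
    have hd : (2 : ℤ) ∣ ((b + 1 : ℕ) : ℤ) - t := two_dvd_of_residue (by rw [hz]; push_cast; rfl)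
    refine ⟨t, ?_, rfl⟩
    rw [abs_lt] at h1 ⊢
    push_cast at h1 hd
    omega
  · rintro ⟨t, h1, rfl⟩
    exact ⟨t, by push_cast; omega, rfl⟩

theorem Near.mono {a b : ℕ} (h : a ≤ b) {z : ZMod (2 * m)} (hz : Near a z) : Near b z := by
  obtain ⟨t, h1, rfl⟩ := hz
  exact ⟨t, by omega, rfl⟩

theorem Near.add_one {b : ℕ} {z : ZMod (2 * m)} (hz : Near b z) : Near (b + 1) (z + 1) := by
  obtain ⟨t, h1, rfl⟩ := hz
  refine ⟨t + 1, ?_, by push_cast; rfl⟩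
  rw [abs_lt] at h1 ⊢
  push_cast
  omega

theorem Near.sub_one {b : ℕ} {z : ZMod (2 * m)} (hz : Near b z) : Near (b + 1) (z - 1) := by
  obtain ⟨t, h1, rfl⟩ := hz
  refine ⟨t - 1, ?_, by push_cast; rfl⟩
  rw [abs_lt] at h1 ⊢
  push_cast
  omega

theorem Near.add_one_and_sub_one {b : ℕ} {z : ZMod (2 * m)} (hz : Near b z)
    (hp : residue z = (b : ZMod 2)) : Near b (z + 1) ∧ Near b (z - 1) := by
  obtain ⟨t, h1, rfl⟩ := hz
  have hd := two_dvd_of_residue hp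
  rw [abs_lt] at h1
  refine ⟨⟨t + 1, ?_, by push_cast; rfl⟩, ⟨t - 1, ?_, by push_cast; rfl⟩⟩ <;> rw [abs_lt] <;> omega

theorem Near.add_one_or_sub_one {b : ℕ} (hb : 1 ≤ b) {z : ZMod (2 * m)} (hz : Near (b + 1) z) :
    Near (b + 1) (z + 1) ∨ Near (b + 1) (z - 1) := by
  obtain ⟨t, h1, rfl⟩ := hz
  rw [abs_lt] at h1
  push_cast at h1
  rcases le_or_gt t 0 with h | h
  · left
    refine ⟨t + 1, ?_, by push_cast; rfl⟩
    rw [abs_lt]; push_cast; omega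
  · right
    refine ⟨t - 1, ?_, by push_cast; rfl⟩
    rw [abs_lt]; push_cast; omega

end Residue

section Cells

variable {m n : ℕ}

/-- The faces of the torus whose row and column have parity `ρ`. -/
abbrev Cell (m n : ℕ) (ρ : ZMod 2) : Type :=
  {p : Square m n // residue p.1 = ρ ∧ residue p.2 = ρ}

/-- The next or previous row or column. -/
def shift (s : Bool) (z : ZMod (2 * m)) : ZMod (2 * m) := bif s then z + 1 else z - 1

theorem residue_shift (s : Bool) (z : ZMod (2 * m)) : residue (shift s z) = residue z + 1 := by
  cases s <;> simp [shift]
  generalize residue z = x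
  revert x; decide

theorem shift_not_shift (s : Bool) (z : ZMod (2 * m)) : shift (!s) (shift s z) = z := by
  cases s <;> simp [shift]

theorem shift_shift_not (s : Bool) (z : ZMod (2 * m)) : shift s (shift (!s) z) = z := by
  cases s <;> simp [shift]

theorem shift_eq_iff (s : Bool) (z w : ZMod (2 * m)) : shift s z = w ↔ z = shift (!s) w := by
  constructor
  · rintro rfl; rw [shift_not_shift]
  · rintro rfl; rw [shift_shift_not]

theorem eq_shift_iff (z w : ZMod (2 * m)) : (w = z + 1 ∨ w = z - 1) ↔ ∃ s, w = shift s z := by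
  simp [shift, or_comm]

theorem shift_left_injective (hm : 2 ≤ m) {s t : Bool} {z : ZMod (2 * m)}
    (h : shift s z = shift t z) : s = t := by
  have h2 : ((2 : ℕ) : ZMod (2 * m)) ≠ 0 := by
    rw [Ne, ZMod.natCast_eq_zero_iff]
    intro h
    have := Nat.le_of_dvd (by norm_num) h
    omega
  have key : z + 1 ≠ z - 1 := by
    intro h
    apply h2
    push_cast
    linear_combination h
  cases s <;> cases t <;> simp only [shift, cond_true, cond_false] at h ⊢
  · exact absurd h.symm key
  · exact absurd h key

/-- The corners of a face: left and right, then up and down. -/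
def cellCorner (ρ : ZMod 2) (c : Cell m n ρ) : Bool × Bool → Vertex m n
  | (false, s) => ⟨(c.1.1, shift s c.1.2), by
      rw [parity_eq, residue_shift, c.2.1, c.2.2, zmod_two_add_succ]⟩
  | (true, s) => ⟨(shift s c.1.1, c.1.2), by
      rw [parity_eq, residue_shift, c.2.1, c.2.2, add_comm, zmod_two_add_succ]⟩

theorem cellCorner_false_eq_iff {ρ : ZMod 2} {c : Cell m n ρ} {s : Bool} {u : Vertex m n} :
    cellCorner ρ c (false, s) = u ↔ c.1 = (u.1.1, shift (!s) u.1.2) := by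
  rw [Subtype.ext_iff, Prod.ext_iff, Prod.ext_iff]
  simp only [cellCorner, shift_eq_iff]

theorem cellCorner_true_eq_iff {ρ : ZMod 2} {c : Cell m n ρ} {s : Bool} {u : Vertex m n} :
    cellCorner ρ c (true, s) = u ↔ c.1 = (shift (!s) u.1.1, u.1.2) := by
  rw [Subtype.ext_iff, Prod.ext_iff, Prod.ext_iff]
  simp only [cellCorner, shift_eq_iff]

theorem torus_isCellular (hm : 2 ≤ m) (hn : 2 ≤ n) (ρ : ZMod 2) :
    IsCellular (torus m n) (cellCorner ρ) where
  adj_iff := by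
    intro u w
    change ((_ ∨ _) ∧ (_ ∨ _)) ↔ _
    rw [eq_shift_iff, eq_shift_iff]
    constructor
    · rintro ⟨⟨s, hs⟩, ⟨t, ht⟩⟩
      by_cases h : residue u.1.1 = ρ
      · have h2 := residue_snd_of_fst u.2 h
        refine ⟨⟨(u.1.1, w.1.2), h, ?_⟩, !t, s, Or.inl ⟨?_, ?_⟩⟩
        · rw [ht, residue_shift, h2, zmod_two_add_one_add_one]
        · rw [eq_comm, cellCorner_false_eq_iff, Bool.not_not]; exact Prod.ext rfl ht
        · rw [eq_comm, cellCorner_true_eq_iff, hs, shift_not_shift]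
      · have h1 := zmod_two_eq_add_one_of_ne h
        have h2 := residue_snd_of_fst u.2 h1
        have h3 : residue u.1.2 = ρ := by rw [h2, zmod_two_add_one_add_one]
        refine ⟨⟨(w.1.1, u.1.2), ?_, h3⟩, t, !s, Or.inr ⟨?_, ?_⟩⟩
        · rw [hs, residue_shift, h1, zmod_two_add_one_add_one]
        · rw [eq_comm, cellCorner_false_eq_iff, ht, shift_not_shift]
        · rw [eq_comm, cellCorner_true_eq_iff, Bool.not_not]; exact Prod.ext hs rfl
    · rintro ⟨c, a, b, ⟨rfl, rfl⟩ | ⟨rfl, rfl⟩⟩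
      · exact ⟨⟨b, rfl⟩, ⟨!a, (shift_not_shift _ _).symm⟩⟩
      · exact ⟨⟨!b, (shift_not_shift _ _).symm⟩, ⟨a, rfl⟩⟩
  inj := by
    intro c a b c' a' b' h1 h2
    rw [Subtype.ext_iff, Prod.ext_iff] at h1 h2
    have hc : c = c' := Subtype.ext (Prod.ext h1.1 h2.2)
    subst hc
    rw [shift_left_injective hn h1.2, shift_left_injective hm h2.1]
  ne := by
    intro c a c' b h
    rw [Subtype.ext_iff, Prod.ext_iff] at h
    have h1 := congrArg residue h.1
    simp only [cellCorner, residue_shift, c.2.1, c'.2.1] at h1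
    exact zmod_two_add_one_ne ρ h1.symm

variable [DecidableEq (Vertex m n)]

open Classical in
theorem cornerSum_cellCorner {ρ : ZMod 2} [Fintype (Cell m n ρ)] (f : Square m n → ℕ)
    (u : Vertex m n) :
    cornerSum (cellCorner ρ) (fun c _ => f c.1) u =
      if residue u.1.1 = ρ then f (u.1.1, u.1.2 + 1) + f (u.1.1, u.1.2 - 1)
      else f (u.1.1 + 1, u.1.2) + f (u.1.1 - 1, u.1.2) := by
  have key : ∀ (q : Square m n), (∑ c : Cell m n ρ, if c.1 = q then f c.1 else 0) =
      if residue q.1 = ρ ∧ residue q.2 = ρ then f q else 0 := by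
    intro q
    split_ifs with h
    · rw [sum_eq_single (⟨q, h⟩ : Cell m n ρ)]
      · simp
      · intro c _ hc
        rw [if_neg]
        exact fun h' => hc (Subtype.ext h')
      · simp
    · refine sum_eq_zero fun c _ => ?_
      rw [if_neg]
      rintro rfl
      exact h c.2
  unfold cornerSum
  rw [sum_comm, Fintype.sum_prod_type]
  simp only [Fintype.sum_bool, cellCorner_false_eq_iff, cellCorner_true_eq_iff, key, residue_shift]
  simp only [shift, Bool.not_true, Bool.not_false, cond_true, cond_false]
  by_cases h : residue u.1.1 = ρ
  · have h2 := residue_snd_of_fst u.2 h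
    have e := zmod_two_add_one_add_one ρ
    have e' := zmod_two_add_one_ne ρ
    simp only [h, h2, e, e', and_true, and_false, if_true, if_false]
    omega
  · have h1 := zmod_two_eq_add_one_of_ne h
    have h2 := residue_snd_of_fst u.2 h1
    have e := zmod_two_add_one_add_one ρ
    have e' := zmod_two_add_one_ne ρ
    simp only [h1, h2, e, e', and_true, and_false, if_true, if_false]
    omega

end Cells

section Rect

variable {m n : ℕ}

/-- The board with the given center and with `2 a - 1` rows and `2 b - 1` columns. -/
def rect (a b : ℕ) (c : Square m n) : Set (Square m n) :=
  {p | Near a (p.1 - c.1) ∧ Near b (p.2 - c.2)}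

/-- The center of a board is placed so that the faces with coordinates of parity `ρ` include those
next to its corners in the boards of half sizes `a, b + 1` and `a + 1, b`. -/
def IsAligned (ρ : ZMod 2) (a b : ℕ) (c : Square m n) : Prop :=
  residue c.1 = ρ + a + 1 ∧ residue c.2 = ρ + b + 1

theorem residue_sub_center {m : ℕ} {z c : ZMod (2 * m)} {ρ x : ZMod 2} (hz : residue z = ρ)
    (hc : residue c = ρ + x + 1) : residue (z - c) = x + 1 := by
  have key : ∀ ρ x : ZMod 2, ρ - (ρ + x + 1) = x + 1 := by decide
  rw [residue_sub, hz, hc, key]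

theorem residue_succ_sub_center {m : ℕ} {z c : ZMod (2 * m)} {ρ x : ZMod 2} (hz : residue z = ρ + 1)
    (hc : residue c = ρ + x + 1) : residue (z - c) = x := by
  have key : ∀ ρ x : ZMod 2, ρ + 1 - (ρ + x + 1) = x := by decide
  rw [residue_sub, hz, hc, key]

variable {ρ : ZMod 2} {a b : ℕ} {c : Square m n}

theorem mem_inter_rect {p : Square m n} :
    p ∈ rect a (b + 1) c ∩ rect (a + 1) b c ↔ Near a (p.1 - c.1) ∧ Near b (p.2 - c.2) := by
  constructor
  · rintro ⟨h1, h2⟩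
    exact ⟨h1.1, h2.2⟩
  · rintro ⟨h1, h2⟩
    exact ⟨⟨h1, h2.mono (Nat.le_succ b)⟩, ⟨h1.mono (Nat.le_succ a), h2⟩⟩

open Classical in
theorem rect_add_rect (ha : 1 ≤ a) (hb : 1 ≤ b) (ham : a + 1 ≤ m) (hbn : b + 1 ≤ n)
    (hc : IsAligned ρ a b c) (u : Vertex m n) :
    (if u.1 ∈ rect a (b + 1) c then 1 else 0) + (if u.1 ∈ rect (a + 1) b c then 1 else 0) =
      if residue u.1.1 = ρ then
        (if (u.1.1, u.1.2 + 1) ∈ rect a (b + 1) c ∩ rect (a + 1) b c then 1 else 0) +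
        (if (u.1.1, u.1.2 - 1) ∈ rect a (b + 1) c ∩ rect (a + 1) b c then 1 else 0)
      else (if (u.1.1 + 1, u.1.2) ∈ rect a (b + 1) c ∩ rect (a + 1) b c then 1 else 0) +
        (if (u.1.1 - 1, u.1.2) ∈ rect a (b + 1) c ∩ rect (a + 1) b c then 1 else 0) := by
  simp only [mem_inter_rect]
  by_cases h : residue u.1.1 = ρ
  · have h2 := residue_snd_of_fst u.2 h
    have hx := residue_sub_center h hc.1
    have hy : residue (u.1.2 - c.2) = b := residue_succ_sub_center h2 hc.2
    have key := near_add_near_succ hb hbn hy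
    have e1 : u.1.2 + 1 - c.2 = u.1.2 - c.2 + 1 := by ring
    have e2 : u.1.2 - 1 - c.2 = u.1.2 - c.2 - 1 := by ring
    rw [if_pos h, e1, e2]
    simp only [rect, Set.mem_ofPred_eq, near_succ_iff hx]
    by_cases hn : Near a (u.1.1 - c.1)
    · simp only [hn, true_and]
      omega
    · simp [hn]
  · have h1 := zmod_two_eq_add_one_of_ne h
    have h2 := residue_snd_of_fst u.2 h1
    rw [zmod_two_add_one_add_one] at h2
    have hy := residue_sub_center h2 hc.2
    have hx : residue (u.1.1 - c.1) = a := residue_succ_sub_center h1 hc.1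
    have key := near_add_near_succ ha ham hx
    have e1 : u.1.1 + 1 - c.1 = u.1.1 - c.1 + 1 := by ring
    have e2 : u.1.1 - 1 - c.1 = u.1.1 - c.1 - 1 := by ring
    rw [if_neg h, e1, e2]
    simp only [rect, Set.mem_ofPred_eq, near_succ_iff hy]
    by_cases hn : Near b (u.1.2 - c.2)
    · simp only [hn, and_true]
      omega
    · simp [hn]

theorem cellCorner_false_mem_rect {q : Cell m n ρ}
    (hq : q.1 ∈ rect a (b + 1) c ∩ rect (a + 1) b c) (s : Bool) :
    (cellCorner ρ q (false, s)).1 ∈ rect a (b + 1) c := by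
  rw [mem_inter_rect] at hq
  refine ⟨hq.1, ?_⟩
  cases s
  · exact (by ring : q.1.2 - c.2 - 1 = q.1.2 - 1 - c.2) ▸ hq.2.sub_one
  · exact (by ring : q.1.2 - c.2 + 1 = q.1.2 + 1 - c.2) ▸ hq.2.add_one

theorem cellCorner_true_mem_rect {q : Cell m n ρ}
    (hq : q.1 ∈ rect a (b + 1) c ∩ rect (a + 1) b c) (s : Bool) :
    (cellCorner ρ q (true, s)).1 ∈ rect (a + 1) b c := by
  rw [mem_inter_rect] at hq
  refine ⟨?_, hq.2⟩
  cases s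
  · exact (by ring : q.1.1 - c.1 - 1 = q.1.1 - 1 - c.1) ▸ hq.1.sub_one
  · exact (by ring : q.1.1 - c.1 + 1 = q.1.1 + 1 - c.1) ▸ hq.1.add_one

theorem cell_mem_rect_iff (hc : IsAligned ρ a b c) (q : Cell m n ρ) :
    (q.1 ∈ rect a (b + 1) c ↔ q.1 ∈ rect a (b + 1) c ∩ rect (a + 1) b c) ∧
    (q.1 ∈ rect (a + 1) b c ↔ q.1 ∈ rect a (b + 1) c ∩ rect (a + 1) b c) := by
  have hx := residue_sub_center q.2.1 hc.1
  have hy := residue_sub_center q.2.2 hc.2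
  rw [mem_inter_rect]
  simp only [rect, Set.mem_ofPred_eq, near_succ_iff hx, near_succ_iff hy, and_self]

/-- The set contains the two vertices next to the face `g` in one direction, and at least one in
the other direction. -/
def SurroundsFace (R : Set (Square m n)) (g : Square m n) : Prop :=
  ((g.1, g.2 + 1) ∈ R ∧ (g.1, g.2 - 1) ∈ R ∧ ((g.1 + 1, g.2) ∈ R ∨ (g.1 - 1, g.2) ∈ R)) ∨
  ((g.1 + 1, g.2) ∈ R ∧ (g.1 - 1, g.2) ∈ R ∧ ((g.1, g.2 + 1) ∈ R ∨ (g.1, g.2 - 1) ∈ R))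

theorem surroundsFace_rect_left (ha : 1 ≤ a) {g : Square m n} (hg2 : residue (g.2 - c.2) = b)
    (hg : g ∈ rect (a + 1) b c) : SurroundsFace (rect (a + 1) b c) g := by
  have h2 := hg.2.add_one_and_sub_one hg2
  have e1 : g.2 + 1 - c.2 = g.2 - c.2 + 1 := by ring
  have e2 : g.2 - 1 - c.2 = g.2 - c.2 - 1 := by ring
  have e3 : g.1 + 1 - c.1 = g.1 - c.1 + 1 := by ring
  have e4 : g.1 - 1 - c.1 = g.1 - c.1 - 1 := by ring
  left
  simp only [rect, Set.mem_ofPred_eq, e1, e2, e3, e4]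
  exact ⟨⟨hg.1, h2.1⟩, ⟨hg.1, h2.2⟩,
    (hg.1.add_one_or_sub_one ha).imp (fun h => ⟨h, hg.2⟩) (fun h => ⟨h, hg.2⟩)⟩

theorem surroundsFace_rect_right (hb : 1 ≤ b) {g : Square m n} (hg1 : residue (g.1 - c.1) = a)
    (hg : g ∈ rect a (b + 1) c) : SurroundsFace (rect a (b + 1) c) g := by
  have h2 := hg.1.add_one_and_sub_one hg1
  have e1 : g.2 + 1 - c.2 = g.2 - c.2 + 1 := by ring
  have e2 : g.2 - 1 - c.2 = g.2 - c.2 - 1 := by ring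
  have e3 : g.1 + 1 - c.1 = g.1 - c.1 + 1 := by ring
  have e4 : g.1 - 1 - c.1 = g.1 - c.1 - 1 := by ring
  right
  simp only [rect, Set.mem_ofPred_eq, e1, e2, e3, e4]
  exact ⟨⟨h2.1, hg.2⟩, ⟨h2.2, hg.2⟩,
    (hg.2.add_one_or_sub_one hb).imp (fun h => ⟨hg.1, h⟩) (fun h => ⟨hg.1, h⟩)⟩

theorem SurroundsFace.exists_vertex_mem {R R' : Set (Square m n)} {g : Square m n}
    (hpar : parity g = 0) (h : SurroundsFace R g) (h' : SurroundsFace R' g) :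
    ∃ u : Vertex m n, u.1 ∈ R ∧ u.1 ∈ R' := by
  have key : ∀ q : Square m n, (q = (g.1, g.2 + 1) ∨ q = (g.1, g.2 - 1) ∨ q = (g.1 + 1, g.2) ∨
      q = (g.1 - 1, g.2)) → q ∈ R → q ∈ R' → ∃ u : Vertex m n, u.1 ∈ R ∧ u.1 ∈ R' := by
    intro q hq h1 h2
    refine ⟨⟨q, ?_⟩, h1, h2⟩
    rw [parity_eq] at hpar
    rcases hq with rfl | rfl | rfl | rfl <;> rw [parity_eq] <;>
      simp only [residue_add, residue_sub, residue_one]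
    · linear_combination hpar
    · rw [add_sub_assoc', hpar]; rfl
    · linear_combination hpar
    · rw [sub_add_eq_add_sub, hpar]; rfl
  rcases h with ⟨h1, h2, h3⟩ | ⟨h1, h2, h3⟩ <;> rcases h' with ⟨h4, h5, h6⟩ | ⟨h4, h5, h6⟩
  · exact key _ (by tauto) h1 h4
  · rcases h3 with h3 | h3
    · exact key _ (by tauto) h3 h4
    · exact key _ (by tauto) h3 h5
  · rcases h3 with h3 | h3
    · exact key _ (by tauto) h3 h4
    · exact key _ (by tauto) h3 h5
  · exact key _ (by tauto) h1 h4

end Rect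

section Step

variable {m n : ℕ} {ι : Type*} [Fintype ι]

/-- The vertices covered by a family of boards. -/
def boardVerts (R : ι → Set (Square m n)) : Set (Vertex m n) := {u | ∃ i, u.1 ∈ R i}

theorem sum_ite_eq_ite_exists {P : ι → Prop} [DecidablePred P] [Decidable (∃ i, P i)] (h : ∀ i j, P i → P j → i = j) :
    ∑ i, (if P i then 1 else 0) = if ∃ i, P i then 1 else 0 := by
  split_ifs with h1
  · obtain ⟨i, hi⟩ := h1
    rw [sum_eq_single i]
    · simp [hi]
    · intro j _ hj
      rw [if_neg]
      exact fun h2 => hj (h _ _ h2 hi)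
    · simp
  · refine sum_eq_zero fun i _ => if_neg fun h2 => h1 ⟨i, h2⟩

/-- Two families of boards are related by one complementation step. -/
structure IsStep (ρ : ZMod 2) (R R' : ι → Set (Square m n)) : Prop where
  identity : ∀ i (u : Vertex m n), open Classical in
    (if u.1 ∈ R i then 1 else 0) + (if u.1 ∈ R' i then 1 else 0) =
      if residue u.1.1 = ρ then
        (if (u.1.1, u.1.2 + 1) ∈ R i ∩ R' i then 1 else 0) +
        (if (u.1.1, u.1.2 - 1) ∈ R i ∩ R' i then 1 else 0)
      else (if (u.1.1 + 1, u.1.2) ∈ R i ∩ R' i then 1 else 0) +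
        (if (u.1.1 - 1, u.1.2) ∈ R i ∩ R' i then 1 else 0)
  corner_mem : ∀ i (q : Cell m n ρ), q.1 ∈ R i ∩ R' i → ∃ j, ∀ s, (cellCorner ρ q (j, s)).1 ∈ R i
  corner_mem' : ∀ i (q : Cell m n ρ), q.1 ∈ R i ∩ R' i →
    ∃ j, ∀ s, (cellCorner ρ q (j, s)).1 ∈ R' i
  cell_mem : ∀ i (q : Cell m n ρ), q.1 ∈ R' i → q.1 ∈ R i
  surrounds : ∀ i (g : Square m n), residue g.1 = ρ + 1 → residue g.2 = ρ + 1 → g ∈ R' i →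
    SurroundsFace (R' i) g

theorem isStep_rect {ρ : ZMod 2} {a b : ι → ℕ} {c : ι → Square m n}
    (ha : ∀ i, 1 ≤ a i) (hb : ∀ i, 1 ≤ b i) (ham : ∀ i, a i + 1 ≤ m) (hbn : ∀ i, b i + 1 ≤ n)
    (hc : ∀ i, IsAligned ρ (a i) (b i) (c i)) {R R' : ι → Set (Square m n)}
    (hR : ∀ i, (R i = rect (a i) (b i + 1) (c i) ∧ R' i = rect (a i + 1) (b i) (c i)) ∨
      (R i = rect (a i + 1) (b i) (c i) ∧ R' i = rect (a i) (b i + 1) (c i))) :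
    IsStep ρ R R' where
  identity i u := by
    classical
    have key := rect_add_rect (ha i) (hb i) (ham i) (hbn i) (hc i) u
    rcases hR i with ⟨h1, h2⟩ | ⟨h1, h2⟩
    · rw [h1, h2]; exact key
    · rw [h1, h2, add_comm]
      have e : ∀ p, p ∈ rect (a i) (b i + 1) (c i) ∩ rect (a i + 1) (b i) (c i) ↔
          p ∈ rect (a i + 1) (b i) (c i) ∩ rect (a i) (b i + 1) (c i) := fun p => and_comm
      exact key.trans (if_congr Iff.rfl
        (congrArg₂ _ (if_congr (e _) rfl rfl) (if_congr (e _) rfl rfl))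
        (congrArg₂ _ (if_congr (e _) rfl rfl) (if_congr (e _) rfl rfl)))
  corner_mem i q hq := by
    rcases hR i with ⟨h1, h2⟩ | ⟨h1, h2⟩
    · rw [h1, h2] at hq; rw [h1]
      exact ⟨false, cellCorner_false_mem_rect hq⟩
    · rw [h1, h2, Set.inter_comm] at hq; rw [h1]
      exact ⟨true, cellCorner_true_mem_rect hq⟩
  corner_mem' i q hq := by
    rcases hR i with ⟨h1, h2⟩ | ⟨h1, h2⟩
    · rw [h1, h2] at hq; rw [h2]
      exact ⟨true, cellCorner_true_mem_rect hq⟩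
    · rw [h1, h2, Set.inter_comm] at hq; rw [h2]
      exact ⟨false, cellCorner_false_mem_rect hq⟩
  cell_mem i q hq := by
    have key := cell_mem_rect_iff (hc i) q
    rcases hR i with ⟨h1, h2⟩ | ⟨h1, h2⟩
    · rw [h2] at hq; rw [h1]
      exact (key.2.mp hq).1
    · rw [h2] at hq; rw [h1]
      exact (key.1.mp hq).2
  surrounds i g hg1 hg2 hg := by
    rcases hR i with ⟨h1, h2⟩ | ⟨h1, h2⟩
    · rw [h2] at hg ⊢
      exact surroundsFace_rect_left (ha i) (residue_succ_sub_center hg2 (hc i).2) hg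
    · rw [h2] at hg ⊢
      exact surroundsFace_rect_right (hb i) (residue_succ_sub_center hg1 (hc i).1) hg

open Classical in
theorem IsStep.pairwise_disjoint_and_mul_pow [NeZero m] [NeZero n] (hm : 2 ≤ m) (hn : 2 ≤ n)
    {ρ : ZMod 2}
    {R R' : ι → Set (Square m n)} (hRR : IsStep ρ R R') {r : ℝ} (hr : r ^ 4 = 2)
    (hdisj : ∀ i j p, p ∈ R i → p ∈ R j → i = j)
    (hne : numPerfectMatchings (torusWithHoles m n (boardVerts R)) ≠ 0) :
    (∀ i j p, p ∈ R' i → p ∈ R' j → i = j) ∧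
    (numPerfectMatchings (torusWithHoles m n (boardVerts R)) : ℝ) *
        r ^ (∑ u : Vertex m n, if u ∈ boardVerts R' then 0 else 1) =
      numPerfectMatchings (torusWithHoles m n (boardVerts R')) *
        r ^ (∑ u : Vertex m n, if u ∈ boardVerts R then 0 else 1) := by
  have hG := torus_isCellular hm hn ρ
  set F : Finset (Cell m n ρ) := {q | ∃ i, q.1 ∈ R i ∩ R' i} with hF
  have hsumR : ∀ u : Vertex m n, ∑ i, (if u.1 ∈ R i then 1 else 0) =
      if u ∈ boardVerts R then 1 else 0 := fun u =>
    (sum_ite_eq_ite_exists fun i j h1 h2 => hdisj i j _ h1 h2).trans (if_congr Iff.rfl rfl rfl)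
  have hsumF : ∀ p, ∑ i, (if p ∈ R i ∩ R' i then 1 else 0) =
      if ∃ i, p ∈ R i ∩ R' i then 1 else 0 := fun p =>
    sum_ite_eq_ite_exists fun i j h1 h2 => hdisj i j _ h1.1 h2.1
  have hident : ∀ u : Vertex m n, (if u ∈ boardVerts R then 1 else 0) +
      ∑ i, (if u.1 ∈ R' i then 1 else 0) =
      cornerSum (cellCorner ρ) (fun c _ => if c ∈ F then 1 else 0) u := by
    intro u
    have e : (fun (c : Cell m n ρ) (_ : Bool × Bool) => if c ∈ F then 1 else 0) =
        fun c _ => (fun p : Square m n => if ∃ i, p ∈ R i ∩ R' i then 1 else 0) c.1 := by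
      funext c _
      simp [hF]
    rw [e, cornerSum_cellCorner fun p : Square m n => if ∃ i, p ∈ R i ∩ R' i then 1 else 0, ← hsumR, ← sum_add_distrib]
    simp only [← hsumF]
    rw [sum_congr rfl fun i _ => hRR.identity i u]
    split_ifs <;> rw [sum_add_distrib]
  have htwo : ∀ u : Vertex m n, cornerSum (cellCorner ρ) (fun c _ => if c ∈ F then 0 else 1) u +
      cornerSum (cellCorner ρ) (fun c _ => if c ∈ F then 1 else 0) u = 2 := by
    intro u
    rw [cornerSum_add]
    have e : (fun (c : Cell m n ρ) (_ : Bool × Bool) => (if c ∈ F then 0 else 1) +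
        if c ∈ F then 1 else 0) = fun c _ => (fun _ : Square m n => 1) c.1 := by
      funext c _
      split_ifs <;> rfl
    rw [e, cornerSum_cellCorner fun _ : Square m n => 1]
    split_ifs <;> rfl
  have hFR : ∀ c ∈ F, ∃ j, ∀ s,
      (fun u : Vertex m n => if u ∈ boardVerts R then 0 else 1) (cellCorner ρ c (j, s)) = 0 := by
    intro c hc
    simp only [hF, mem_filter, mem_univ, true_and] at hc
    obtain ⟨i, hi⟩ := hc
    obtain ⟨j, hj⟩ := hRR.corner_mem i c hi
    exact ⟨j, fun s => if_pos ⟨i, hj s⟩⟩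
  have hFR' : ∀ c ∈ F, ∃ j, ∀ s,
      (fun u : Vertex m n => if u ∈ boardVerts R' then 0 else 1) (cellCorner ρ c (j, s)) = 0 := by
    intro c hc
    simp only [hF, mem_filter, mem_univ, true_and] at hc
    obtain ⟨i, hi⟩ := hc
    obtain ⟨j, hj⟩ := hRR.corner_mem' i c hi
    exact ⟨j, fun s => if_pos ⟨i, hj s⟩⟩
  have hle : ∀ S : Set (Vertex m n), ∀ u, (fun u => if u ∈ S then 0 else 1) u ≤ 1 := by
    intro S u
    dsimp only
    split_ifs <;> omega
  unfold torusWithHoles at hne ⊢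
  rw [numPerfectMatchings_induce_compl hG] at hne
  rw [numPerfectMatchings_induce_compl hG, numPerfectMatchings_induce_compl hG]
  have hvert1 : ∀ u : Vertex m n, ∑ i, (if u.1 ∈ R' i then 1 else 0) ≤ 1 := by
    intro u
    have h1 := le_cornerSum_of_cellularCount_ne_zero (hle (boardVerts R)) hFR hne u
    have h2 := hident u
    have h3 := htwo u
    split_ifs at h1 h2 <;> omega
  have hvert : ∀ i j (u : Vertex m n), u.1 ∈ R' i → u.1 ∈ R' j → i = j := by
    intro i j u hi hj
    by_contra hij
    have h1 := hvert1 u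
    have h2 : ∑ l ∈ {i, j}, (if u.1 ∈ R' l then 1 else 0) ≤ ∑ l, (if u.1 ∈ R' l then 1 else 0) :=
      sum_le_sum_of_subset (subset_univ _)
    rw [sum_pair hij, if_pos hi, if_pos hj] at h2
    omega
  refine ⟨?_, ?_⟩
  · intro i j p hi hj
    by_cases hp : parity p = 1
    · exact hvert i j ⟨p, hp⟩ hi hj
    · have hp0 : parity p = 0 := by
        rw [zmod_two_eq_add_one_of_ne hp]; rfl
      have hp12 : residue p.1 = residue p.2 := by
        rw [parity_eq] at hp0
        rw [eq_neg_of_add_eq_zero_left hp0, CharTwo.neg_eq]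
      by_cases h : residue p.1 = ρ
      · exact hdisj i j p (hRR.cell_mem i ⟨p, h, hp12 ▸ h⟩ hi) (hRR.cell_mem j ⟨p, h, hp12 ▸ h⟩ hj)
      · have h1 := zmod_two_eq_add_one_of_ne h
        have h2 : residue p.2 = ρ + 1 := hp12 ▸ h1
        obtain ⟨u, hu1, hu2⟩ := (hRR.surrounds i p h1 h2 hi).exists_vertex_mem hp0
          (hRR.surrounds j p h1 h2 hj)
        exact hvert i j u hu1 hu2
  · refine cellularCount_mul_pow (F := F) hr (hle _) (hle _) ?_ hFR hFR'
    intro u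
    have h2 := hident u
    have h3 := htwo u
    have h4 : _ = if u ∈ boardVerts R' then 1 else 0 :=
      (sum_ite_eq_ite_exists fun i j h1 h2 => hvert i j u h1 h2).trans (if_congr Iff.rfl rfl rfl)
    rw [h4] at h2
    split_ifs at h2 ⊢ <;> omega

end Step

section Coloring

variable {m n : ℕ}

theorem exists_nat_of_residue [NeZero m] (z : ZMod (2 * m)) :
    ∃ i : ℕ, z = ((2 * i : ℕ) : ZMod (2 * m)) ∧ residue z = 0 ∨
      z = ((2 * i + 1 : ℕ) : ZMod (2 * m)) ∧ residue z = 1 := by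
  obtain ⟨t, rfl⟩ : ∃ t : ℕ, (t : ZMod (2 * m)) = z := ⟨z.val, ZMod.natCast_zmod_val z⟩
  have e : residue (t : ZMod (2 * m)) = (t : ZMod 2) := map_natCast _ t
  rcases Nat.even_or_odd' t with ⟨i, rfl | rfl⟩
  · exact ⟨i, Or.inl ⟨rfl, by rw [e, Nat.cast_mul]; exact zero_mul _⟩⟩
  · refine ⟨i, Or.inr ⟨rfl, ?_⟩⟩
    rw [e, Nat.cast_add, Nat.cast_mul, Nat.cast_one, add_eq_right]
    exact zero_mul _

theorem exists_color_iff [NeZero m] [NeZero n] (C : (torus m n).Coloring Bool) :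
    ∃ ρ : ZMod 2, ∀ v : Vertex m n, C v = true ↔ residue v.1.1 = ρ := by
  let f : Square m n → Bool := fun p => if h : parity p = 1 then C ⟨p, h⟩ else false
  have hf : ∀ v : Vertex m n, f v.1 = C v := fun v => dif_pos v.2
  have key : ∀ x y, parity ((x, y) : Square m n) = 1 → f (x + 1, y + 1) = !f (x, y) ∧
      f (x + 1, y - 1) = !f (x, y) := by
    intro x y h
    have e1 : parity ((x + 1, y + 1) : Square m n) = 1 := by
      rw [parity_eq] at h ⊢
      simp only [residue_add, residue_one] at h ⊢
      rw [show residue x + 1 + (residue y + 1) = residue x + residue y + 1 + 1 by ring, h]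
      rfl
    have e2 : parity ((x + 1, y - 1) : Square m n) = 1 := by
      rw [parity_eq] at h ⊢
      simp only [residue_add, residue_sub, residue_one] at h ⊢
      rw [← h]; ring
    have a1 : (torus m n).Adj ⟨(x, y), h⟩ ⟨(x + 1, y + 1), e1⟩ := ⟨Or.inl rfl, Or.inl rfl⟩
    have a2 : (torus m n).Adj ⟨(x, y), h⟩ ⟨(x + 1, y - 1), e2⟩ := ⟨Or.inl rfl, Or.inr rfl⟩
    have c1 := C.valid a1
    have c2 := C.valid a2
    rw [← hf, ← hf] at c1 c2
    exact ⟨(Bool.eq_not_of_ne c1.symm), (Bool.eq_not_of_ne c2.symm)⟩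
  have hbase : ∀ i j : ℕ, parity (((2 * i : ℕ), (2 * j + 1 : ℕ)) : Square m n) = 1 := by
    intro i j
    rw [parity_eq]
    change ZMod.castHom _ _ _ + ZMod.castHom _ _ _ = _
    rw [map_natCast, map_natCast]
    have : (2 : ZMod 2) = 0 := rfl
    push_cast
    rw [this]; ring
  have hrow : ∀ x y, parity ((x, y) : Square m n) = 1 → f (x + 1 + 1, y) = f (x, y) := by
    intro x y h
    have h1 := (key x y h).1
    have h2 := (key (x + 1) (y + 1) (by
      rw [parity_eq] at h ⊢
      simp only [residue_add, residue_one] at h ⊢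
      rw [show residue x + 1 + (residue y + 1) = residue x + residue y + 1 + 1 by ring, h]
      rfl)).2
    rw [h1, add_sub_cancel_right, Bool.not_not] at h2
    exact h2
  have hcol : ∀ x y, parity ((x, y) : Square m n) = 1 → f (x, y + 1 + 1) = f (x, y) := by
    intro x y h
    have h1 := key (x - 1) (y + 1) (by
      rw [parity_eq] at h ⊢
      simp only [residue_add, residue_sub, residue_one] at h ⊢
      rw [← h]; ring)
    rw [sub_add_cancel, add_sub_cancel_right] at h1
    rw [h1.1, h1.2]
  have heven : ∀ i j : ℕ, f ((2 * i : ℕ), (2 * j + 1 : ℕ)) = f ((2 * 0 : ℕ), (2 * 0 + 1 : ℕ)) := by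
    intro i j
    induction i with
    | zero =>
      induction j with
      | zero => rfl
      | succ j ih =>
        rw [← ih, ← hcol _ _ (hbase 0 j)]
        congr 2
        push_cast; ring
    | succ i ih =>
      rw [← ih, ← hrow _ _ (hbase i j)]
      congr 2
      push_cast; ring
  have hval : ∀ v : Vertex m n, residue v.1.1 = 0 → C v = f ((2 * 0 : ℕ), (2 * 0 + 1 : ℕ)) := by
    rintro ⟨⟨x, y⟩, h⟩ hx
    have hy := residue_snd_of_fst h hx
    rw [← hf]
    dsimp only at hx hy ⊢
    obtain ⟨i, ⟨rfl, -⟩ | ⟨-, h1⟩⟩ := exists_nat_of_residue x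
    · obtain ⟨j, ⟨-, h1⟩ | ⟨rfl, -⟩⟩ := exists_nat_of_residue y
      · rw [h1] at hy; exact absurd hy (by decide)
      · exact heven i j
    · rw [h1] at hx; exact absurd hx (by decide)
  have hval' : ∀ v : Vertex m n, residue v.1.1 = 1 → C v = !f ((2 * 0 : ℕ), (2 * 0 + 1 : ℕ)) := by
    rintro ⟨⟨x, y⟩, h⟩ hx
    have h1 : parity ((x - 1, y + 1) : Square m n) = 1 := by
      rw [parity_eq] at h ⊢
      simp only [residue_add, residue_sub, residue_one] at h ⊢
      rw [← h]; ring
    have h2 := (key _ _ h1).2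
    rw [sub_add_cancel, add_sub_cancel_right] at h2
    have h3 := hval ⟨_, h1⟩ (by simp only [residue_sub, residue_one]; rw [hx]; rfl)
    rw [← hf] at h3 ⊢
    rw [h2, h3]
  generalize f ((2 * 0 : ℕ), (2 * 0 + 1 : ℕ)) = β at hval hval'
  refine ⟨if β = true then 0 else 1, fun v => ?_⟩
  by_cases hv : residue v.1.1 = 0
  · rw [hval v hv, hv]
    cases β <;> simp
  · have hv1 : residue v.1.1 = 1 := by rw [zmod_two_eq_add_one_of_ne hv, zero_add]
    rw [hval' v hv1, hv1]
    cases β <;> simp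

end Coloring

section Stage

variable {m n k : ℕ}

/-- The boards that interpolate between a slit and its flip. -/
def stage (O : Multiplet m n k) (p : ℕ) : Set (Square m n) :=
  match O.orientation with
  | .horizontal => rect p (k + 1 - p) O.center
  | .vertical => rect (k + 1 - p) p O.center

theorem near_one_iff {z : ZMod (2 * m)} : Near 1 z ↔ z = 0 := by
  constructor
  · rintro ⟨t, h, rfl⟩
    rw [abs_lt] at h
    have : t = 0 := by push_cast at h; omega
    rw [this, Int.cast_zero]
  · rintro rfl
    exact ⟨0, by norm_num, Int.cast_zero⟩

theorem zsmul_step_horizontal (t : ℤ) :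
    t • Orientation.step m n .horizontal = ((0, (t : ZMod (2 * n))) : Square m n) := by
  simp [Orientation.step]

theorem zsmul_step_vertical (t : ℤ) :
    t • Orientation.step m n .vertical = (((t : ZMod (2 * m)), 0) : Square m n) := by
  simp [Orientation.step]

theorem horizontal_board (c : Square m n) :
    {p | ∃ t : ℤ, |t| < (k : ℤ) ∧ p = c + t • Orientation.step m n .horizontal} = rect 1 k c := by
  ext ⟨x, y⟩
  simp only [zsmul_step_horizontal, rect, Set.mem_ofPred_eq, near_one_iff, Prod.ext_iff,
    Prod.fst_add, Prod.snd_add, add_zero, sub_eq_zero]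
  constructor
  · rintro ⟨t, h, rfl, rfl⟩
    exact ⟨rfl, t, h, by ring⟩
  · rintro ⟨rfl, t, h, h2⟩
    exact ⟨t, h, rfl, by rw [h2]; ring⟩

theorem vertical_board (c : Square m n) :
    {p | ∃ t : ℤ, |t| < (k : ℤ) ∧ p = c + t • Orientation.step m n .vertical} = rect k 1 c := by
  ext ⟨x, y⟩
  simp only [zsmul_step_vertical, rect, Set.mem_ofPred_eq, near_one_iff, Prod.ext_iff,
    Prod.fst_add, Prod.snd_add, add_zero, sub_eq_zero]
  constructor
  · rintro ⟨t, h, rfl, rfl⟩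
    exact ⟨⟨t, h, by ring⟩, rfl⟩
  · rintro ⟨⟨t, h, h2⟩, rfl⟩
    exact ⟨t, h, by rw [h2]; ring, rfl⟩

theorem stage_one (O : Multiplet m n k) : stage O 1 = O.board := by
  obtain ⟨o, c, h⟩ := O
  cases o
  · exact (horizontal_board c).symm
  · exact (vertical_board c).symm

theorem stage_last (O : Multiplet m n k) : stage O k = O.flip.board := by
  obtain ⟨o, c, h⟩ := O
  unfold stage
  rw [Nat.add_sub_cancel_left]
  cases o
  · exact (vertical_board c).symm
  · exact (horizontal_board c).symm

theorem parity_center_add (O : Multiplet m n k) (t : ℤ) :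
    parity (O.center + t • O.orientation.step m n) = k + (t : ZMod 2) := by
  rw [← O.parity_center, parity_eq, parity_eq]
  rcases O.orientation
  · rw [zsmul_step_horizontal]
    simp only [Prod.fst_add, Prod.snd_add, residue_add, residue_zero, residue_intCast]
    ring
  · rw [zsmul_step_vertical]
    simp only [Prod.fst_add, Prod.snd_add, residue_add, residue_zero, residue_intCast]
    ring

theorem intCast_injOn {k : ℕ} (hk : k ≤ m) {s t : ℤ} (hs : |s| < k) (ht : |t| < k)
    (h : (s : ZMod (2 * m)) = t) : s = t := by
  rw [ZMod.intCast_eq_intCast_iff_dvd_sub] at h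
  rw [abs_lt] at hs ht
  have := Int.eq_zero_of_abs_lt_dvd h (by rw [abs_lt]; push_cast; omega)
  omega

open Classical in
theorem card_verts [NeZero m] [NeZero n] (hkm : k ≤ m) (hkn : k ≤ n) (O : Multiplet m n k) :
    (∑ u : Vertex m n, if u.1 ∈ O.board then 1 else 0) =
      #((Ioo (-(k : ℤ)) k).filter fun t : ℤ => (k : ZMod 2) + (t : ZMod 2) = 1) := by
  rw [← card_filter]
  symm
  refine card_bij (fun t ht => ⟨O.center + t • O.orientation.step m n, ?_⟩) ?_ ?_ ?_
  · rw [parity_center_add]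
    exact (mem_filter.mp ht).2
  · intro t ht
    rw [mem_filter, mem_Ioo] at ht
    exact mem_filter.mpr ⟨mem_univ _, t, abs_lt.mpr ht.1, rfl⟩
  · intro t ht s hs h
    rw [mem_filter, mem_Ioo] at ht hs
    have h1 := add_left_cancel (congrArg Subtype.val h)
    rcases ho : O.orientation
    · rw [ho, zsmul_step_horizontal, zsmul_step_horizontal] at h1
      exact intCast_injOn hkn (abs_lt.mpr ht.1) (abs_lt.mpr hs.1) (congrArg Prod.snd h1)
    · rw [ho, zsmul_step_vertical, zsmul_step_vertical] at h1
      exact intCast_injOn hkm (abs_lt.mpr ht.1) (abs_lt.mpr hs.1) (congrArg Prod.fst h1)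
  · rintro ⟨u, hu⟩ h
    obtain ⟨t, h1, h2⟩ := (mem_filter.mp h).2
    dsimp only at h2
    subst h2
    rw [parity_center_add] at hu
    exact ⟨t, mem_filter.mpr ⟨mem_Ioo.mpr (abs_lt.mp h1), hu⟩, rfl⟩

open Classical in
theorem sum_compl_boardVerts [NeZero m] [NeZero n] {ι : Type*} [Fintype ι]
    {R : ι → Set (Square m n)} (hR : ∀ i j p, p ∈ R i → p ∈ R j → i = j) :
    (∑ u : Vertex m n, if u ∈ boardVerts R then 0 else 1) +
      ∑ i, ∑ u : Vertex m n, (if u.1 ∈ R i then 1 else 0) = Fintype.card (Vertex m n) := by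
  rw [sum_comm, ← sum_add_distrib, Fintype.card_eq_sum_ones]
  refine sum_congr rfl fun u _ => ?_
  have h : _ = if u ∈ boardVerts R then 1 else 0 :=
    (sum_ite_eq_ite_exists fun i j h1 h2 => hR i j u.1 h1 h2).trans (if_congr Iff.rfl rfl rfl)
  rw [h]
  split_ifs <;> rfl

theorem center_residue {ρ : ZMod 2} {C : (torus m n).Coloring Bool} (hk : 1 ≤ k)
    (hC : ∀ v : Vertex m n, C v = true ↔ residue v.1.1 = ρ) {O : Multiplet m n k}
    (hO : (O.orientation = .horizontal ∧ O.IsPlaced C true) ∨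
      (O.orientation = .vertical ∧ O.IsPlaced C false)) :
    (O.orientation = .horizontal ∧ residue O.center.1 = ρ ∧ residue O.center.2 = ρ + k) ∨
      (O.orientation = .vertical ∧ residue O.center.1 = ρ + k ∧ residue O.center.2 = ρ) := by
  have hpar := O.parity_center
  rw [parity_eq] at hpar
  have hv : parity (O.center + ((k : ℤ) - 1) • O.orientation.step m n) = 1 := by
    rw [parity_center_add]
    push_cast
    generalize (k : ZMod 2) = x
    revert x; decide
  have hmem : (⟨_, hv⟩ : Vertex m n) ∈ O.verts := ⟨(k : ℤ) - 1, by rw [abs_lt]; omega, rfl⟩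
  have harith : ∀ x y κ : ZMod 2, x + y = κ → y = x + κ := by decide
  rcases hO with ⟨h1, h2⟩ | ⟨h1, h2⟩
  · left
    have h3 := (hC _).mp (h2 _ hmem)
    simp only [h1, zsmul_step_horizontal, Prod.fst_add, add_zero] at h3
    refine ⟨h1, h3, ?_⟩
    rw [← h3]
    exact harith _ _ _ hpar
  · right
    have h3 : residue (O.center + ((k : ℤ) - 1) • O.orientation.step m n).1 ≠ ρ := by
      intro h
      have := (hC ⟨_, hv⟩).mpr h
      rw [h2 _ hmem] at this
      exact absurd this (by decide)
    have h4 := residue_snd_of_fst hv (zmod_two_eq_add_one_of_ne h3)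
    rw [zmod_two_add_one_add_one] at h4
    simp only [h1, zsmul_step_vertical, Prod.snd_add, add_zero] at h4
    refine ⟨h1, ?_, h4⟩
    rw [← h4]
    rw [add_comm] at hpar
    exact harith _ _ _ hpar

theorem isStep_stage {ι : Type*} [Fintype ι] {ρ : ZMod 2} {O : ι → Multiplet m n k}
    (hkm : k ≤ m) (hkn : k ≤ n)
    (hO : ∀ i, ((O i).orientation = .horizontal ∧ residue (O i).center.1 = ρ ∧
        residue (O i).center.2 = ρ + k) ∨
      ((O i).orientation = .vertical ∧ residue (O i).center.1 = ρ + k ∧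
        residue (O i).center.2 = ρ)) {p : ℕ} (hp : 1 ≤ p) (hpk : p < k) :
    IsStep (ρ + p + 1) (fun i => stage (O i) p) (fun i => stage (O i) (p + 1)) := by
  classical
  have e1 : ∀ x y : ZMod 2, x = x + y + 1 + y + 1 := by decide
  obtain ⟨q, rfl⟩ : ∃ q, k = p + q := ⟨k - p, by omega⟩
  have e2 : ∀ x y z : ZMod 2, x + (y + z) = x + y + 1 + z + 1 := by decide
  have s1 : p + q + 1 - p = q + 1 := by omega
  have s2 : p + q + 1 - (p + 1) = q := by omega
  refine isStep_rect (a := fun i => if (O i).orientation = .horizontal then p else q)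
    (b := fun i => if (O i).orientation = .horizontal then q else p)
    (c := fun i => (O i).center) ?_ ?_ ?_ ?_ ?_ ?_
  · intro i; split_ifs <;> omega
  · intro i; split_ifs <;> omega
  · intro i; split_ifs <;> omega
  · intro i; split_ifs <;> omega
  · intro i
    rcases hO i with ⟨h1, h2, h3⟩ | ⟨h1, h2, h3⟩
    · simp only [h1, if_true]
      push_cast at h3
      exact ⟨h2.trans (e1 _ _), h3.trans (e2 _ _ _)⟩
    · simp only [h1, reduceCtorEq, if_false]
      push_cast at h2
      exact ⟨h2.trans (e2 _ _ _), h3.trans (e1 _ _)⟩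
  · intro i
    rcases hO i with ⟨h1, -⟩ | ⟨h1, -⟩
    · left
      simp only [stage, h1, if_true, s1, s2, and_self]
    · right
      simp only [stage, h1, reduceCtorEq, if_false, s1, s2, and_self]

open Classical in
theorem stage_invariant [NeZero m] [NeZero n] {ι : Type*} [Fintype ι] {ρ : ZMod 2}
    {O : ι → Multiplet m n k} (hm : 2 ≤ m) (hn : 2 ≤ n) (hkm : k ≤ m) (hkn : k ≤ n)
    (hO : ∀ i, ((O i).orientation = .horizontal ∧ residue (O i).center.1 = ρ ∧
        residue (O i).center.2 = ρ + k) ∨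
      ((O i).orientation = .vertical ∧ residue (O i).center.1 = ρ + k ∧
        residue (O i).center.2 = ρ))
    (hdisj : ∀ i j p, p ∈ stage (O i) 1 → p ∈ stage (O j) 1 → i = j)
    (hne : numPerfectMatchings (torusWithHoles m n (boardVerts fun i => stage (O i) 1)) ≠ 0)
    {r : ℝ} (hr : r ^ 4 = 2) {p : ℕ} (hp : 1 ≤ p) (hpk : p ≤ k) :
    (∀ i j x, x ∈ stage (O i) p → x ∈ stage (O j) p → i = j) ∧
    numPerfectMatchings (torusWithHoles m n (boardVerts fun i => stage (O i) p)) ≠ 0 ∧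
    (numPerfectMatchings (torusWithHoles m n (boardVerts fun i => stage (O i) 1)) : ℝ) *
        r ^ (∑ u : Vertex m n, if u ∈ (boardVerts fun i => stage (O i) p) then 0 else 1) =
      numPerfectMatchings (torusWithHoles m n (boardVerts fun i => stage (O i) p)) *
        r ^ (∑ u : Vertex m n, if u ∈ (boardVerts fun i => stage (O i) 1) then 0 else 1) := by
  have hr0 : r ≠ 0 := by
    rintro rfl
    norm_num at hr
  induction p, hp using Nat.le_induction with
  | base => exact ⟨hdisj, hne, rfl⟩
  | succ p hp ih =>
    obtain ⟨h1, h2, h3⟩ := ih (by omega)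
    obtain ⟨h4, h5⟩ := (isStep_stage hkm hkn hO hp (by omega)).pairwise_disjoint_and_mul_pow
      hm hn hr h1 h2
    refine ⟨h4, ?_, ?_⟩
    · intro h0
      rw [h0, Nat.cast_zero, zero_mul] at h5
      exact mul_ne_zero (Nat.cast_ne_zero.mpr h2) (pow_ne_zero _ hr0) h5
    · refine mul_right_cancel₀ (pow_ne_zero _ hr0 : r ^ (∑ u : Vertex m n,
        if u ∈ (boardVerts fun i => stage (O i) p) then 0 else 1) ≠ 0) ?_
      rw [mul_right_comm, h3, mul_right_comm, h5]
      ring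

theorem iUnion_verts_eq {ι : Type*} (O : ι → Multiplet m n k) :
    ⋃ i, (O i).verts = boardVerts fun i => (O i).board := by
  ext u
  simp [boardVerts, Multiplet.verts]

theorem verts_flip_of_length_one (O : Multiplet m n 1) : O.flip.verts = O.verts := by
  have h : O.flip.board = O.board := (stage_last O).symm.trans (stage_one O)
  unfold Multiplet.verts
  rw [h]

theorem numPerfectMatchings_flip {ι : Type*} [Fintype ι] (hk : 1 ≤ k) (hkm : k ≤ m) (hkn : k ≤ n)
    (C : (torus m n).Coloring Bool) (O : ι → Multiplet m n k)
    (hO : ∀ i, ((O i).orientation = .horizontal ∧ (O i).IsPlaced C true) ∨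
      ((O i).orientation = .vertical ∧ (O i).IsPlaced C false))
    (hdisj : ∀ i j, i ≠ j → Disjoint (O i).board (O j).board)
    (hpm : ∃ M : (torusWithHoles m n (⋃ i, (O i).verts)).Subgraph, M.IsPerfectMatching) :
    numPerfectMatchings (torusWithHoles m n (⋃ i, (O i).verts)) =
      numPerfectMatchings (torusWithHoles m n (⋃ i, (O i).flip.verts)) := by
  classical
  obtain rfl | hk2 : k = 1 ∨ 2 ≤ k := by omega
  · have h : ⋃ i, (O i).flip.verts = ⋃ i, (O i).verts := by
      simp only [verts_flip_of_length_one]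
    rw [h]
  have : NeZero m := ⟨by omega⟩
  have : NeZero n := ⟨by omega⟩
  obtain ⟨r, hr⟩ : ∃ r : ℝ, r ^ 4 = 2 :=
    ⟨√(√2), by rw [show (4 : ℕ) = 2 * 2 from rfl, pow_mul, Real.sq_sqrt (Real.sqrt_nonneg 2),
      Real.sq_sqrt (by norm_num)]⟩
  have hr0 : r ≠ 0 := by
    rintro rfl
    norm_num at hr
  obtain ⟨ρ, hC⟩ := exists_color_iff C
  have hfirst : ⋃ i, (O i).verts = boardVerts fun i => stage (O i) 1 := by
    simp only [stage_one, iUnion_verts_eq]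
  have hlast : ⋃ i, (O i).flip.verts = boardVerts fun i => stage (O i) k := by
    simp only [stage_last, iUnion_verts_eq]
  have hd : ∀ i j p, p ∈ stage (O i) 1 → p ∈ stage (O j) 1 → i = j := by
    intro i j p hi hj
    by_contra hij
    rw [stage_one] at hi hj
    exact Set.disjoint_left.mp (hdisj i j hij) hi hj
  have hne : numPerfectMatchings (torusWithHoles m n (boardVerts fun i => stage (O i) 1)) ≠ 0 := by
    rw [← hfirst]
    obtain ⟨M, hM⟩ := hpm
    exact Nat.card_ne_zero.mpr ⟨⟨⟨M, hM⟩⟩, inferInstance⟩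
  obtain ⟨h1, -, h3⟩ := stage_invariant (by omega) (by omega) hkm hkn
    (fun i => center_residue hk hC (hO i)) hd hne hr hk le_rfl
  have hcount : (∑ u : Vertex m n, if u ∈ (boardVerts fun i => stage (O i) 1) then 0 else 1) =
      ∑ u : Vertex m n, if u ∈ (boardVerts fun i => stage (O i) k) then 0 else 1 := by
    have e1 := sum_compl_boardVerts hd
    have e2 := sum_compl_boardVerts h1
    simp only [stage_one, stage_last, card_verts hkm hkn] at e1 e2 ⊢
    omega
  rw [hcount] at h3
  rw [hfirst, hlast]
  exact_mod_cast mul_right_cancel₀ (pow_ne_zero _ hr0) h3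

end Stage

end AztecTorus

theorem corollary4p5 (m n k s : ℕ) (hk : 1 ≤ k) (hkm : k ≤ m) (hkn : k ≤ n)
    (C : (AztecTorus.torus m n).Coloring Bool)
    (O : Fin (2 * s) → AztecTorus.Multiplet m n k)
    (hO : ∀ i,
      ((O i).orientation = AztecTorus.Orientation.horizontal ∧ (O i).IsPlaced C true) ∨
      ((O i).orientation = AztecTorus.Orientation.vertical ∧ (O i).IsPlaced C false))
    (hs : {i | (O i).orientation = AztecTorus.Orientation.horizontal}.ncard = s)
    (hdisj : ∀ i j, i ≠ j → Disjoint (O i).board (O j).board)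
    (hpm : ∃ M : (AztecTorus.torusWithHoles m n (⋃ i, (O i).verts)).Subgraph,
      M.IsPerfectMatching) :
    AztecTorus.numPerfectMatchings (AztecTorus.torusWithHoles m n (⋃ i, (O i).verts)) =
        AztecTorus.numPerfectMatchings (AztecTorus.torusWithHoles m n (⋃ i, (O i).flip.verts)) ∧
      AztecTorus.finiteSizeCorrelation m n (⋃ i, (O i).verts) =
        AztecTorus.finiteSizeCorrelation m n (⋃ i, (O i).flip.verts) := by
  have h := AztecTorus.numPerfectMatchings_flip hk hkm hkn C O hO hdisj hpm
  exact ⟨h, by unfold AztecTorus.finiteSizeCorrelation; rw [h]⟩
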